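/- **Definitions.** Let $f$ be a transcendental entire function. Its Fatou set is the set of points that have a neighbourhood on which the iterates $(f^n)_{n\ge 0}$ form a normal family, and its Fatou components are the connected components of the Fatou set. Let $U$ be a simply connected wandering domain of $f$, that is, a simply connected Fatou component that is neither periodic nor preperiodic; for $n\ge 0$ let $U_n$ be the Fatou component containing $f^n(U)$ (so the $U_n$ are pairwise distinct). Let $\operatorname{dist}_{U_n}$ be the hyperbolic distance in $U_n$, normalised so that the density of the unit disk is $2/(1-|w|^2)$. For $z\in U$ and $n\ge 0$ let $$\lambda_n(z)=\lim_{z'\to f^n(z)}\frac{\operatorname{dist}_{U_{n+1}}\big(f(z'),f(f^n(z))\big)}{\operatorname{dist}_{U_n}\big(z',f^n(z)\big)}$$ be the hyperbolic distortion of $f:U_n\to U_{n+1}$ at $f^n(z)$. We say that $U$ is *strongly contracting* if there is $c\in(0,1)$ such that $\operatorname{dist}_{U_n}(f^n(z),f^n(z'))=O(c^n)$ as $n\to\infty$ for all $z,z'\in U$, and *super-contracting* if $\lim_{n\to\infty}\big(\operatorname{dist}_{U_n}(f^n(z),f^n(z'))\big)^{1/n}=0$ for all $z,z'\in U$. **Theorem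 B.** Let $U$ be a simply connected wandering domain of a transcendental entire function $f$, and fix $z_0\in U$. The limits $\lambda_n(z)$ exist and lie in $[0,1]$ for all $z\in U$ and $n\ge 0$, and: (a) If $\limsup_{n\to\infty}\frac1n\sum_{k=1}^n\lambda_k(z_0)<1$, then $U$ is strongly contracting. (b) If $\lim_{n\to\infty}\frac1n\sum_{k=1}^n\lambda_k(z_0)=0$, then $U$ is super-contracting. (c) For every $z\in U$, $\limsup_{n\to\infty}\frac1n\sum_{k=1}^n\lambda_k(z)=\limsup_{n\to\infty}\frac1n\sum_{k=1}^n\lambda_k(z_0)$. -/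

import Mathlib

open Filter Topology Asymptotics

noncomputable section

/-- `f` is a transcendental entire function: holomorphic on `ℂ` and not a polynomial. -/
def IsTranscendentalEntire (f : ℂ → ℂ) : Prop :=
  Differentiable ℂ f ∧ ¬ ∃ p : Polynomial ℂ, ∀ z, f z = p.eval z

/-- The sequence `g` tends to `∞`, uniformly on every compact subset of `V`. -/
def TendstoInftyOnCompacts (g : ℕ → ℂ → ℂ) (V : Set ℂ) : Prop :=
  ∀ K ⊆ V, IsCompact K → ∀ R : ℝ, ∀ᶠ k in atTop, ∀ z ∈ K, R < ‖g k z‖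

/-- The family of iterates of `f` is normal on `V` (in the sense of Montel): every sequence of
iterates has a subsequence that converges locally uniformly on `V`, either to a finite
function or to `∞`. -/
def IteratesNormalOn (f : ℂ → ℂ) (V : Set ℂ) : Prop :=
  ∀ n : ℕ → ℕ, ∃ φ : ℕ → ℕ, StrictMono φ ∧
    ((∃ g : ℂ → ℂ, TendstoLocallyUniformlyOn (fun k => f^[n (φ k)]) g atTop V) ∨
      TendstoInftyOnCompacts (fun k => f^[n (φ k)]) V)

/-- The Fatou set: the points with an open neighbourhood on which the iterates are normal. -/
def fatouSet (f : ℂ → ℂ) : Set ℂ :=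
  {z | ∃ V : Set ℂ, IsOpen V ∧ z ∈ V ∧ IteratesNormalOn f V}

/-- `U` is a Fatou component of `f`: a connected component of the Fatou set. -/
def IsFatouComponent (f : ℂ → ℂ) (U : Set ℂ) : Prop :=
  ∃ z ∈ fatouSet f, U = connectedComponentIn (fatouSet f) z

/-- For a Fatou component `U`, the Fatou component `U_n` that contains `f^n(U)`.
(Since `U` is not empty, there is at most one such component.) -/
def fatouOrbit (f : ℂ → ℂ) (U : Set ℂ) (n : ℕ) : Set ℂ :=
  ⋃₀ {V | IsFatouComponent f V ∧ f^[n] '' U ⊆ V}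

/-- `U` is a wandering domain: a Fatou component that is neither periodic nor preperiodic,
i.e. the components `U_0 = U, U_1, U_2, …` are distinct. -/
def IsWanderingDomain (f : ℂ → ℂ) (U : Set ℂ) : Prop :=
  IsFatouComponent f U ∧ ∀ m n : ℕ, m ≠ n → fatouOrbit f U m ≠ fatouOrbit f U n

/-- The hyperbolic distance of the unit disk, for the density `2 / (1 - |w|^2)`:
`log ((1 + δ) / (1 - δ))` with `δ = |w - w'| / |1 - conj w * w'|`. -/
def diskDist (w w' : ℂ) : ℝ :=
  Real.log ((1 + ‖w - w'‖ / ‖1 - (starRingEnd ℂ) w * w'‖) /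
    (1 - ‖w - w'‖ / ‖1 - (starRingEnd ℂ) w * w'‖))

/-- `π` restricts to a holomorphic covering map of the unit disk onto `U`
(a universal covering, since the disk is simply connected). -/
structure IsDiskCovering (π : ℂ → ℂ) (U : Set ℂ) : Prop where
  holo : DifferentiableOn ℂ π (Metric.ball 0 1)
  image_eq : π '' Metric.ball 0 1 = U
  covering : IsCoveringMapOn (fun w : Metric.ball (0 : ℂ) 1 => π w) U

/-- The hyperbolic distance of a hyperbolic domain `U`: the least distance, in the unit disk,
between preimages of the two points under a holomorphic universal covering of `U` by the disk.
(Two such coverings differ by an automorphism of the disk, so they give the same value; if `U` is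
simply connected, the covering is the inverse of a Riemann map.) -/
def hypDist (U : Set ℂ) (z z' : ℂ) : ℝ :=
  sInf {d | ∃ π : ℂ → ℂ, IsDiskCovering π U ∧ ∃ w ∈ Metric.ball (0 : ℂ) 1,
    ∃ w' ∈ Metric.ball (0 : ℂ) 1, π w = z ∧ π w' = z' ∧ d = diskDist w w'}

/-- The quotient `dist_V(f(z'), f(z)) / dist_U(z', z)`. -/
def hypQuotient (f : ℂ → ℂ) (U V : Set ℂ) (z z' : ℂ) : ℝ :=
  hypDist V (f z') (f z) / hypDist U z' z

/-- The hyperbolic distortion of `f : U → V` at `z`: the limit of the quotient as `z' → z`. -/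
def hypDistortion (f : ℂ → ℂ) (U V : Set ℂ) (z : ℂ) : ℝ :=
  limUnder (𝓝[≠] z) (hypQuotient f U V z)

/-- `λ_n(z)`: the hyperbolic distortion of `f : U_n → U_{n+1}` at `f^n(z)`. -/
def orbitDistortion (f : ℂ → ℂ) (U : Set ℂ) (n : ℕ) (z : ℂ) : ℝ :=
  hypDistortion f (fatouOrbit f U n) (fatouOrbit f U (n + 1)) (f^[n] z)

/-- `(1/n) (λ_1(z) + … + λ_n(z))`. -/
def averageDistortion (f : ℂ → ℂ) (U : Set ℂ) (z : ℂ) (n : ℕ) : ℝ :=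
  (1 / (n : ℝ)) * ∑ k ∈ Finset.Icc 1 n, orbitDistortion f U k z

/-- `dist_{U_n}(f^n(z), f^n(z'))`. -/
def orbitDist (f : ℂ → ℂ) (U : Set ℂ) (z z' : ℂ) (n : ℕ) : ℝ :=
  hypDist (fatouOrbit f U n) (f^[n] z) (f^[n] z')

/-- `U` is strongly contracting. -/
def IsStronglyContracting (f : ℂ → ℂ) (U : Set ℂ) : Prop :=
  ∃ c : ℝ, 0 < c ∧ c < 1 ∧
    ∀ z ∈ U, ∀ z' ∈ U, orbitDist f U z z' =O[atTop] (fun n : ℕ => c ^ n)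

/-- `U` is super-contracting. -/
def IsSuperContracting (f : ℂ → ℂ) (U : Set ℂ) : Prop :=
  ∀ z ∈ U, ∀ z' ∈ U,
    Tendsto (fun n : ℕ => orbitDist f U z z' n ^ (1 / (n : ℝ))) atTop (𝓝 0)

end

/-! Holomorphic coverings of the components `U_n` by the unit disk, centred at the points f^n(z₀),
turn f : U_n → U_{n+1} into self-maps F_n of the disk that fix 0, and λ_n(z₀) becomes |F_n'(0)|
(`exists_orbitModel`, `tendsto_hypQuotient`). A point of U becomes an orbit w_n in the disk. With
r_n = |w_n|, Schwarz–Pick applied to F_n(w)/w gives the recursion r_{n+1} ≤ r_n (r_n + λ_n)/(1 + r_n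
λ_n) (`norm_le_of_deriv_zero`), from which the rest follows.

If r_n does not tend to 0, the recursion forces ∑(1 - λ_n) < ∞, so the means of λ_n tend to 1
(`tendsto_zero_or_tendsto_cesaroMean_one`). If r_n → 0, the factors are at most λ_n + r_n, whose
means have the same limsup as those of λ_n, and the inequality of arithmetic and geometric means
gives r_n = O(c^n) for every c > 0 above that limsup (`isBigO_pow_of_limsup_lt`). A limsup below 1
excludes the first case, which proves (a); arbitrarily small c proves (b).

For (c): if r_n → 0, the distortions along the two orbits differ by a null sequence, because
derivatives of self-maps of the disk are equicontinuous near 0. Otherwise, recentring F_n at w_n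
gives the same recursion for the same r_n with the distortions of the other point, so both means
tend to 1.

The coverings come from an extremal problem. Since U_n misses the open set U_{n+1}, a Möbius map
makes it a bounded domain Ω. Among the self-maps K of the disk that fix 0 and lift all holomorphic
maps from the disk to Ω, one minimises |K'(0)|; Koebe's square root trick shows that the extremal K
takes values in Ω (`exists_isDiscLifting_of_subset_ball`), and the lifting property makes it a
covering (`IsDiscLifting.isDiskCovering`). -/

open Metric Set ComplexConjugate

/-! ### Disk automorphisms and Schwarz–Pick estimates -/

/-- The automorphism of the unit disk that exchanges `0` and `a`. -/
noncomputable def discSwap (a z : ℂ) : ℂ := (a - z) / (1 - conj a * z)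

lemma one_sub_conj_mul_ne_zero {a z : ℂ} (ha : a ∈ ball (0 : ℂ) 1) (hz : z ∈ ball (0 : ℂ) 1) :
    1 - conj a * z ≠ 0 := by
  rw [mem_ball_zero_iff] at ha hz
  intro h
  have h1 : ‖conj a * z‖ = 1 := by rw [← sub_eq_zero.1 h]; simp
  rw [norm_mul, RCLike.norm_conj] at h1
  nlinarith [norm_nonneg a, norm_nonneg z]

lemma norm_sq_one_sub_conj_mul (a z : ℂ) :
    ‖1 - conj a * z‖ ^ 2 = ‖a - z‖ ^ 2 + (1 - ‖a‖ ^ 2) * (1 - ‖z‖ ^ 2) := by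
  simp only [Complex.sq_norm, Complex.normSq_apply]
  simp
  ring

lemma norm_discSwap (a z : ℂ) : ‖discSwap a z‖ = ‖a - z‖ / ‖1 - conj a * z‖ := by
  rw [discSwap, norm_div]

lemma one_sub_norm_sq_discSwap {a z : ℂ} (ha : a ∈ ball (0 : ℂ) 1) (hz : z ∈ ball (0 : ℂ) 1) :
    1 - ‖discSwap a z‖ ^ 2 = (1 - ‖a‖ ^ 2) * (1 - ‖z‖ ^ 2) / ‖1 - conj a * z‖ ^ 2 := by
  have h := norm_pos_iff.2 (one_sub_conj_mul_ne_zero ha hz)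
  rw [norm_discSwap, div_pow, eq_div_iff (by positivity), sub_mul, div_mul_cancel₀ _ (by positivity),
    norm_sq_one_sub_conj_mul]
  ring

lemma discSwap_mem {a z : ℂ} (ha : a ∈ ball (0 : ℂ) 1) (hz : z ∈ ball (0 : ℂ) 1) :
    discSwap a z ∈ ball (0 : ℂ) 1 := by
  have h := norm_pos_iff.2 (one_sub_conj_mul_ne_zero ha hz)
  have h1 := one_sub_norm_sq_discSwap ha hz
  rw [mem_ball_zero_iff] at *
  have h2 : 0 < (1 - ‖a‖ ^ 2) * (1 - ‖z‖ ^ 2) / ‖1 - conj a * z‖ ^ 2 := by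
    refine div_pos (mul_pos ?_ ?_) (by positivity) <;> nlinarith [norm_nonneg a, norm_nonneg z]
  nlinarith [norm_nonneg (discSwap a z)]

lemma discSwap_mapsTo {a : ℂ} (ha : a ∈ ball (0 : ℂ) 1) :
    MapsTo (discSwap a) (ball 0 1) (ball 0 1) := fun _ hz => discSwap_mem ha hz

@[simp] lemma discSwap_zero (a : ℂ) : discSwap a 0 = a := by simp [discSwap]

@[simp] lemma discSwap_self (a : ℂ) : discSwap a a = 0 := by simp [discSwap]

lemma discSwap_discSwap {a z : ℂ} (ha : a ∈ ball (0 : ℂ) 1) (hz : z ∈ ball (0 : ℂ) 1) :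
    discSwap a (discSwap a z) = z := by
  have h := one_sub_conj_mul_ne_zero ha hz
  have h2 := one_sub_conj_mul_ne_zero ha (discSwap_mem ha hz)
  have hd : discSwap a z * (1 - conj a * z) = a - z := div_mul_cancel₀ _ h
  rw [discSwap, div_eq_iff h2]
  apply mul_right_cancel₀ h
  linear_combination (-1 + conj a * z) * hd

lemma norm_discSwap_comm (a z : ℂ) : ‖discSwap a z‖ = ‖discSwap z a‖ := by
  rw [norm_discSwap, norm_discSwap, norm_sub_rev, ← RCLike.norm_conj (1 - conj a * z)]
  simp [mul_comm]

lemma hasDerivAt_discSwap {a z : ℂ} (ha : a ∈ ball (0 : ℂ) 1) (hz : z ∈ ball (0 : ℂ) 1) :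
    HasDerivAt (discSwap a) (-(1 - (‖a‖ : ℂ) ^ 2) / (1 - conj a * z) ^ 2) z := by
  have h := one_sub_conj_mul_ne_zero ha hz
  have h1 : HasDerivAt (fun z => a - z) (-1) z := by
    simpa using (hasDerivAt_id z).const_sub a
  have h2 : HasDerivAt (fun z => 1 - conj a * z) (-conj a) z := by
    simpa using ((hasDerivAt_id z).const_mul (conj a)).const_sub 1
  refine (h1.div h2 h).congr_deriv ?_
  congr 1
  have := Complex.conj_mul' a
  linear_combination this

lemma differentiableOn_discSwap {a : ℂ} (ha : a ∈ ball (0 : ℂ) 1) :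
    DifferentiableOn ℂ (discSwap a) (ball 0 1) :=
  fun _ hz => (hasDerivAt_discSwap ha hz).differentiableAt.differentiableWithinAt

/-- The **Schwarz–Pick lemma**. -/
lemma norm_discSwap_le {s : ℂ → ℂ} (hs : DifferentiableOn ℂ s (ball 0 1))
    (hm : MapsTo s (ball 0 1) (ball 0 1)) {u v : ℂ} (hu : u ∈ ball (0 : ℂ) 1)
    (hv : v ∈ ball (0 : ℂ) 1) : ‖discSwap (s u) (s v)‖ ≤ ‖discSwap u v‖ := by
  have hd : DifferentiableOn ℂ (discSwap (s u) ∘ s ∘ discSwap u) (ball 0 1) :=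
    (differentiableOn_discSwap (hm hu)).comp
      (hs.comp (differentiableOn_discSwap hu) (discSwap_mapsTo hu))
      (hm.comp (discSwap_mapsTo hu))
  have hmaps : MapsTo (discSwap (s u) ∘ s ∘ discSwap u) (ball 0 1) (closedBall 0 1) :=
    ((discSwap_mapsTo (hm hu)).comp (hm.comp (discSwap_mapsTo hu))).mono_right ball_subset_closedBall
  have := Complex.norm_le_norm_of_mapsTo_ball hd hmaps (by simp)
    (mem_ball_zero_iff.1 (discSwap_mem hu hv))
  simpa [discSwap_discSwap hu hv] using this

/-- For given moduli the pseudo-hyperbolic distance is largest when the points lie on opposite sides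
of 0: then |1 - conj a * z| takes its maximum 1 + |a||z|, and so 1 - ‖discSwap a z‖² is smallest. -/
lemma norm_discSwap_le_div {a z : ℂ} (ha : a ∈ ball (0 : ℂ) 1) (hz : z ∈ ball (0 : ℂ) 1) :
    ‖discSwap a z‖ ≤ (‖a‖ + ‖z‖) / (1 + ‖a‖ * ‖z‖) := by
  have h := norm_pos_iff.2 (one_sub_conj_mul_ne_zero ha hz)
  have h1 := one_sub_norm_sq_discSwap ha hz
  have hp : 0 < 1 + ‖a‖ * ‖z‖ := by positivity
  have hle : ‖1 - conj a * z‖ ≤ 1 + ‖a‖ * ‖z‖ :=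
    (norm_sub_le _ _).trans (by simp)
  rw [mem_ball_zero_iff] at ha hz
  refine abs_le_of_sq_le_sq' ?_ (by positivity) |>.2
  have h2 : 1 - ((‖a‖ + ‖z‖) / (1 + ‖a‖ * ‖z‖)) ^ 2 =
      (1 - ‖a‖ ^ 2) * (1 - ‖z‖ ^ 2) / (1 + ‖a‖ * ‖z‖) ^ 2 := by
    field_simp
    ring
  have h3 : (1 - ‖a‖ ^ 2) * (1 - ‖z‖ ^ 2) / (1 + ‖a‖ * ‖z‖) ^ 2 ≤
      (1 - ‖a‖ ^ 2) * (1 - ‖z‖ ^ 2) / ‖1 - conj a * z‖ ^ 2 := by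
    have : 0 ≤ (1 - ‖a‖ ^ 2) * (1 - ‖z‖ ^ 2) := by
      apply mul_nonneg <;> nlinarith [norm_nonneg a, norm_nonneg z]
    gcongr
  linarith

/-- A holomorphic map from the disk to the closed disk takes values in the open disk as soon as
its value at the origin does. -/
lemma mapsTo_ball_of_mapsTo_closedBall {h : ℂ → ℂ} (hd : DifferentiableOn ℂ h (ball 0 1))
    (hm : MapsTo h (ball 0 1) (closedBall 0 1)) (h0 : h 0 ∈ ball (0 : ℂ) 1) :
    MapsTo h (ball 0 1) (ball 0 1) := by
  intro x hx
  rw [mem_ball_zero_iff] at h0 ⊢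
  have hx1 := mem_closedBall_zero_iff.1 (hm hx)
  refine lt_of_le_of_ne hx1 fun hne => ?_
  have hmax : IsMaxOn (norm ∘ h) (ball 0 1) x := fun y hy => by
    simpa [hne] using mem_closedBall_zero_iff.1 (hm hy)
  have := Complex.norm_eqOn_of_isPreconnected_of_isMaxOn (convex_ball 0 1).isPreconnected
    isOpen_ball hd hx hmax (mem_ball_self one_pos)
  simp only [Function.comp_apply, Function.const_apply] at this
  linarith

/-- Refined **Schwarz lemma**, in terms of the derivative at the fixed point. -/
lemma norm_le_of_deriv_zero {F : ℂ → ℂ} (hd : DifferentiableOn ℂ F (ball 0 1))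
    (hm : MapsTo F (ball 0 1) (ball 0 1)) (h0 : F 0 = 0) {w : ℂ} (hw : w ∈ ball (0 : ℂ) 1) :
    ‖F w‖ ≤ ‖w‖ * ((‖w‖ + ‖deriv F 0‖) / (1 + ‖w‖ * ‖deriv F 0‖)) := by
  have hmc : MapsTo F (ball 0 1) (closedBall (F 0) 1) := by
    rw [h0]; exact hm.mono_right ball_subset_closedBall
  have hmem : MapsTo (dslope F 0) (ball 0 1) (closedBall 0 1) := fun z hz => by
    simpa using Complex.norm_dslope_le_div_of_mapsTo_ball hd hmc hz
  have hdd : DifferentiableOn ℂ (dslope F 0) (ball 0 1) :=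
    (Complex.differentiableOn_dslope (ball_mem_nhds _ one_pos)).2 hd
  have hF : ‖F w‖ = ‖w‖ * ‖dslope F 0 w‖ := by
    have := sub_smul_dslope F 0 w
    simp only [sub_zero, h0, smul_eq_mul] at this
    rw [← this, norm_mul]
  rw [hF]
  refine mul_le_mul_of_nonneg_left ?_ (norm_nonneg _)
  have hd0 : dslope F 0 0 = deriv F 0 := dslope_same F 0
  have hle : ‖deriv F 0‖ ≤ 1 := by
    simpa [hd0] using hmem (mem_ball_self one_pos)
  -- F(w)/w maps into the open disk unless |F'(0)| = 1; in that case the claimed factor equals 1 and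
  -- the plain Schwarz bound suffices.
  rcases hle.lt_or_eq with hlt | heq
  · have hmb := mapsTo_ball_of_mapsTo_closedBall hdd hmem (by simpa [hd0] using hlt)
    have hp0 : deriv F 0 ∈ ball (0 : ℂ) 1 := by simpa using hlt
    set x := dslope F 0 w with hx
    have hsp := norm_discSwap_le hdd hmb (mem_ball_self one_pos) hw
    rw [hd0, ← hx] at hsp
    have h1 : ‖discSwap (0 : ℂ) w‖ = ‖w‖ := by simp [discSwap]
    rw [h1] at hsp
    have hxb := hmb hw
    have h2 := norm_discSwap_le_div hp0 (discSwap_mem hp0 hxb)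
    rw [discSwap_discSwap hp0 hxb] at h2
    refine h2.trans ?_
    have hy := norm_nonneg (discSwap (deriv F 0) x)
    set y := ‖discSwap (deriv F 0) x‖
    set l := ‖deriv F 0‖
    have hl0 : 0 ≤ l := norm_nonneg _
    rw [div_le_div_iff₀ (by positivity) (by positivity)]
    nlinarith [mul_nonneg (sub_nonneg.2 hsp) (show 0 ≤ 1 - l ^ 2 by nlinarith)]
  · rw [heq, mul_one, add_comm, div_self (by positivity)]
    simpa using hmem hw

/-! ### Montel and Hurwitz theorems along filters -/

/-- **Montel's theorem** for maps to the closed disk, along an ultrafilter. -/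
lemma exists_tendstoLocallyUniformlyOn_of_ultrafilter {ι : Type*} (𝒰 : Ultrafilter ι)
    {F : ι → ℂ → ℂ}
    (hd : ∀ᶠ i in 𝒰, DifferentiableOn ℂ (F i) (ball 0 1))
    (hm : ∀ᶠ i in 𝒰, MapsTo (F i) (ball 0 1) (closedBall 0 1)) :
    ∃ G : ℂ → ℂ, TendstoLocallyUniformlyOn F G 𝒰 (ball 0 1) ∧
      DifferentiableOn ℂ G (ball 0 1) ∧ MapsTo G (ball 0 1) (closedBall 0 1) := by
  have hex : ∀ z ∈ ball (0 : ℂ) 1, ∃ y ∈ closedBall (0 : ℂ) 1,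
      Tendsto (fun i => F i z) 𝒰 (𝓝 y) := by
    intro z hz
    have hc : IsCompact (closedBall (0 : ℂ) 1) := isCompact_closedBall 0 1
    obtain ⟨y, hy, hle⟩ := hc.ultrafilter_le_nhds (𝒰.map fun i => F i z)
      (by rw [le_principal_iff]; exact hm.mono fun i hi => hi hz)
    exact ⟨y, hy, hle⟩
  choose! G hGm hGt using hex
  -- A Lipschitz bound common to all F_i upgrades the pointwise limits to locally uniform ones. On
  -- the disk of radius 1 - |x| about x, values differ from F_i(x) by at most 2; Schwarz gives the
  -- constant.
  have hlip : ∀ᶠ i in 𝒰, ∀ x ∈ ball (0 : ℂ) 1, ∀ y ∈ ball x (1 - ‖x‖),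
      dist (F i y) (F i x) ≤ 2 / (1 - ‖x‖) * dist y x := by
    filter_upwards [hd, hm] with i hdi hmi x hx y hy
    have hsub : ball x (1 - ‖x‖) ⊆ ball 0 1 := ball_subset_ball' (by simp)
    refine Complex.dist_le_div_mul_dist_of_mapsTo_ball (hdi.mono hsub) (fun z hz => ?_) hy
    have h1 := mem_closedBall_zero_iff.1 (hmi (hsub hz))
    have h2 := mem_closedBall_zero_iff.1 (hmi hx)
    rw [mem_closedBall, dist_eq_norm]
    linarith [norm_sub_le (F i z) (F i x)]
  have hconv : TendstoLocallyUniformlyOn F G 𝒰 (ball 0 1) := by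
    rw [Metric.tendstoLocallyUniformlyOn_iff]
    intro ε hε x hx
    have hx1 : 0 < 1 - ‖x‖ := by simpa using hx
    set C := 2 / (1 - ‖x‖) with hC
    have hCp : 0 < C := by positivity
    have hsub : ball x (1 - ‖x‖) ⊆ ball 0 1 := ball_subset_ball' (by simp)
    refine ⟨ball x (min (1 - ‖x‖) (ε / (4 * C))),
      mem_nhdsWithin_of_mem_nhds (ball_mem_nhds _ (by positivity)), ?_⟩
    filter_upwards [hlip, (hGt x hx).eventually (ball_mem_nhds _ (show 0 < ε / 4 by positivity))]
      with i hi hix y hy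
    have hy1 : y ∈ ball x (1 - ‖x‖) := ball_subset_ball (min_le_left _ _) hy
    have hy2 : C * dist y x < ε / 4 := by
      have : dist y x < ε / (4 * C) := (mem_ball.1 hy).trans_le (min_le_right _ _)
      rw [lt_div_iff₀ (by positivity)] at this
      linarith
    have hG : dist (G y) (G x) ≤ C * dist y x :=
      le_of_tendsto ((hGt y (hsub hy1)).dist (hGt x hx)) (hlip.mono fun j hj => hj x hx y hy1)
    have h1 := hi x hx y hy1
    have h2 := dist_triangle4 (G y) (G x) (F i x) (F i y)
    rw [dist_comm (G x), dist_comm (F i x) (F i y)] at h2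
    have h3 : dist (F i x) (G x) < ε / 4 := hix
    linarith
  exact ⟨G, hconv, hconv.differentiableOn hd isOpen_ball, hGm⟩

/-- **Hurwitz's theorem**: values of the limit are taken nearby by the approximating functions. -/
lemma eventually_exists_eq_of_tendstoLocallyUniformlyOn {ι : Type*} {l : Filter ι}
    {F : ι → ℂ → ℂ} {G : ℂ → ℂ} (hd : ∀ᶠ i in l, DifferentiableOn ℂ (F i) (ball 0 1))
    (hdG : DifferentiableOn ℂ G (ball 0 1))
    (hF : TendstoLocallyUniformlyOn F G l (ball 0 1)) {w : ℂ} (hw : w ∈ ball (0 : ℂ) 1)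
    (hne : ∀ᶠ z in 𝓝[≠] w, G z ≠ G w) {ρ : ℝ} (hρ : 0 < ρ) :
    ∀ᶠ i in l, ∃ x ∈ ball (0 : ℂ) 1, dist x w < ρ ∧ F i x = G w := by
  obtain ⟨δ, hδ, hδ'⟩ := Metric.mem_nhdsWithin_iff.1 hne
  have hw1 : 0 < 1 - ‖w‖ := by simpa using hw
  obtain ⟨r, hr, hrm⟩ := exists_between (show 0 < min δ (min ρ (1 - ‖w‖)) by positivity)
  have hr1 : r < δ := hrm.trans_le (min_le_left _ _)
  have hr2 : r < ρ := hrm.trans_le ((min_le_right _ _).trans (min_le_left _ _))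
  have hr3 : r < 1 - ‖w‖ := hrm.trans_le ((min_le_right _ _).trans (min_le_right _ _))
  have hsub : closedBall w r ⊆ ball 0 1 := closedBall_subset_ball' (by simp; linarith)
  have hss : sphere w r ⊆ ball 0 1 := sphere_subset_closedBall.trans hsub
  obtain ⟨y, hy, hmin⟩ := (isCompact_sphere w r).exists_isMinOn
    (NormedSpace.sphere_nonempty.2 hr.le)
    ((hdG.continuousOn.mono hss).sub (continuousOn_const (c := G w))).norm
  set e := ‖G y - G w‖ with he
  have hyw : y ≠ w := by
    rintro rfl
    simp at hy
    linarith
  have hep : 0 < e := norm_pos_iff.2 (sub_ne_zero.2 (hδ' ⟨by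
    rw [mem_ball, mem_sphere.1 hy]; exact hr1, hyw⟩))
  have hunif := (tendstoLocallyUniformlyOn_iff_forall_isCompact isOpen_ball).1 hF _ hsub
    (isCompact_closedBall w r)
  -- With error e/8, F_i stays at distance at least e/2 from F_i(w) on the circle. The quantitative
  -- open mapping theorem then covers the disk of radius e/4 about F_i(w), which contains G(w).
  filter_upwards [hd, Metric.tendstoUniformlyOn_iff.1 hunif (e / 8) (by positivity)] with i hdi hi
  have hiw := hi w (mem_closedBall_self hr.le)
  have hs : ∀ z ∈ sphere w r, e / 2 ≤ ‖F i z - F i w‖ := by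
    intro z hz
    have h1 : e ≤ ‖G z - G w‖ := hmin hz
    have h2 := hi z (sphere_subset_closedBall hz)
    rw [dist_eq_norm] at h2 hiw
    have h3 : G z - G w = (G z - F i z) + (F i z - F i w) - (G w - F i w) := by ring
    rw [h3] at h1
    have := norm_sub_le ((G z - F i z) + (F i z - F i w)) (G w - F i w)
    have := norm_add_le (G z - F i z) (F i z - F i w)
    linarith
  have hdc : DiffContOnCl ℂ (F i) (ball w r) :=
    (hdi.mono (by rw [closure_ball w hr.ne']; exact hsub)).diffContOnCl
  have hfreq : ∃ᶠ z in 𝓝 w, F i z ≠ F i w := by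
    intro hcon
    have hev : F i =ᶠ[𝓝 w] fun _ => F i w := hcon.mono fun z hz => not_not.1 hz
    have := (hdi.analyticOnNhd isOpen_ball).eqOn_of_preconnected_of_eventuallyEq
      analyticOnNhd_const (convex_ball 0 1).isPreconnected hw hev (hss hy)
    have h1 := hs y hy
    rw [this] at h1
    simp at h1
    linarith
  have himg := hdc.ball_subset_image_closedBall hr hs hfreq
  obtain ⟨x, hx, hxe⟩ := himg (show G w ∈ ball (F i w) (e / 2 / 2) by
    rw [mem_ball]; linarith)
  exact ⟨x, hsub hx, (mem_closedBall.1 hx).trans_lt hr2, hxe⟩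

/-- One selection must serve all radii in Hurwitz's theorem at once: take a preimage whose distance
to w is within 1/(i+1) of the infimum. -/
lemma exists_seq_tendsto_eq_of_tendstoLocallyUniformlyOn {l : Filter ℕ} (hl : l ≤ atTop)
    {F : ℕ → ℂ → ℂ} {G : ℂ → ℂ} (hd : ∀ᶠ i in l, DifferentiableOn ℂ (F i) (ball 0 1))
    (hdG : DifferentiableOn ℂ G (ball 0 1))
    (hF : TendstoLocallyUniformlyOn F G l (ball 0 1)) {w : ℂ} (hw : w ∈ ball (0 : ℂ) 1)
    (hne : ∀ᶠ z in 𝓝[≠] w, G z ≠ G w) :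
    ∃ x : ℕ → ℂ, Tendsto x l (𝓝 w) ∧ ∀ᶠ i in l, x i ∈ ball (0 : ℂ) 1 ∧ F i (x i) = G w := by
  have key := fun ρ (hρ : 0 < ρ) =>
    eventually_exists_eq_of_tendstoLocallyUniformlyOn hd hdG hF hw hne (ρ := ρ) hρ
  let S : ℕ → Set ℂ := fun i => {x | x ∈ ball (0 : ℂ) 1 ∧ F i x = G w}
  have hsel : ∀ i, ∃ x, (S i).Nonempty → x ∈ S i ∧ dist w x < infDist w (S i) + 1 / (i + 1 : ℝ) := by
    intro i
    by_cases h : (S i).Nonempty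
    · obtain ⟨x, hx, hlt⟩ := (infDist_lt_iff (x := w) h).1
        (lt_add_of_pos_right (infDist w (S i)) (by positivity : (0 : ℝ) < 1 / (i + 1)))
      exact ⟨x, fun _ => ⟨hx, hlt⟩⟩
    · exact ⟨0, fun h' => (h h').elim⟩
  choose x hx using hsel
  refine ⟨x, ?_, (key 1 one_pos).mono fun i ⟨y, hy, _, hy'⟩ => (hx i ⟨y, hy, hy'⟩).1⟩
  rw [Metric.tendsto_nhds]
  intro ε hε
  have h1 : ∀ᶠ i : ℕ in l, 1 / (i + 1 : ℝ) < ε / 2 :=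
    hl (tendsto_one_div_add_atTop_nhds_zero_nat.eventually (gt_mem_nhds (half_pos hε)))
  filter_upwards [h1, key (ε / 2) (half_pos hε)] with i hi ⟨y, hy, hyd, hye⟩
  have := (hx i ⟨y, hy, hye⟩).2
  have h2 : infDist w (S i) ≤ dist w y := infDist_le_dist_of_mem ⟨hy, hye⟩
  rw [dist_comm] at hyd ⊢
  linarith

/-! ### Maps with the disc lifting property -/

/-- A zero-free holomorphic function on the disk has a holomorphic square root. -/
lemma exists_differentiableOn_sq_eq {h : ℂ → ℂ} (hd : DifferentiableOn ℂ h (ball 0 1))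
    (h0 : ∀ x ∈ ball (0 : ℂ) 1, h x ≠ 0) {b : ℂ} (hb : b ^ 2 = h 0) :
    ∃ q : ℂ → ℂ, DifferentiableOn ℂ q (ball 0 1) ∧ q 0 = b ∧
      ∀ x ∈ ball (0 : ℂ) 1, q x ^ 2 = h x := by
  -- A primitive of h'/h is a logarithm of h up to a constant.
  obtain ⟨g, hg⟩ := ((hd.deriv isOpen_ball).div hd h0).isExactOn_ball
  have hgd : DifferentiableOn ℂ g (ball 0 1) :=
    fun z hz => (hg z hz).differentiableAt.differentiableWithinAt
  refine ⟨fun x => b * Complex.exp ((g x - g 0) / 2), ?_, by simp, fun x hx => ?_⟩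
  · exact (((hgd.sub_const _).div_const 2).cexp).const_mul b
  · have hconst : h x * Complex.exp (-(g x - g 0)) = h 0 * Complex.exp (-(g 0 - g 0)) := by
      refine isOpen_ball.is_const_of_deriv_eq_zero (convex_ball (0 : ℂ) 1).isPreconnected
        (f := fun x => h x * Complex.exp (-(g x - g 0)))
        (hd.mul (hgd.sub_const _).neg.cexp) (fun z hz => ?_) hx (mem_ball_self one_pos)
      have h1 := (hd.differentiableAt (isOpen_ball.mem_nhds hz)).hasDerivAt
      have h2 := (((hg z hz).sub_const (g 0)).neg).cexp
      have h3 := (h1.mul h2).deriv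
      have h4 := h0 z hz
      refine Eq.trans h3 ?_
      simp only [Pi.div_apply, Pi.zero_apply]
      field_simp
      ring
    simp only [sub_self, neg_zero, Complex.exp_zero, mul_one] at hconst
    rw [mul_pow, ← Complex.exp_nat_mul, hb, ← hconst, mul_assoc, ← Complex.exp_add]
    simp [mul_div_cancel₀]

/-- Holomorphic maps from the unit disk to `Ω` lift through `K`, with a prescribed value at the
origin. -/
structure IsDiscLifting (K : ℂ → ℂ) (Ω : Set ℂ) : Prop where
  differentiableOn : DifferentiableOn ℂ K (ball 0 1)
  exists_lift : ∀ g : ℂ → ℂ, DifferentiableOn ℂ g (ball 0 1) → MapsTo g (ball 0 1) Ω →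
    ∀ w ∈ ball (0 : ℂ) 1, K w = g 0 → ∃ s : ℂ → ℂ, DifferentiableOn ℂ s (ball 0 1) ∧
      MapsTo s (ball 0 1) (ball 0 1) ∧ s 0 = w ∧ ∀ x ∈ ball (0 : ℂ) 1, K (s x) = g x

/-- Lifting the affine parametrisation of a disk about K(w) gives the inverse branch through w; this
is how the lifting property is used locally. -/
lemma IsDiscLifting.exists_section {K : ℂ → ℂ} {Ω : Set ℂ} (hK : IsDiscLifting K Ω) {w : ℂ}
    (hw : w ∈ ball (0 : ℂ) 1) {r : ℝ} (hr : 0 < r) (hsub : ball (K w) r ⊆ Ω) :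
    ∃ s : ℂ → ℂ, DifferentiableOn ℂ s (ball 0 1) ∧ MapsTo s (ball 0 1) (ball 0 1) ∧ s 0 = w ∧
      ∀ x ∈ ball (0 : ℂ) 1, K (s x) = K w + r * x := by
  refine hK.exists_lift (fun x => K w + r * x) (by fun_prop) (fun x hx => hsub ?_) w hw (by simp)
  rw [mem_ball_zero_iff] at hx
  simp only [mem_ball, dist_self_add_left, norm_mul, Complex.norm_real, Real.norm_of_nonneg hr.le]
  nlinarith

lemma IsDiscLifting.deriv_mul_deriv_section {K : ℂ → ℂ} {Ω : Set ℂ} (hK : IsDiscLifting K Ω)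
    {r : ℝ} {c : ℂ} {s : ℂ → ℂ} (hs : DifferentiableOn ℂ s (ball 0 1))
    (hm : MapsTo s (ball 0 1) (ball 0 1))
    (hsec : ∀ x ∈ ball (0 : ℂ) 1, K (s x) = c + r * x) :
    deriv K (s 0) * deriv s 0 = r := by
  have h0 : (0 : ℂ) ∈ ball (0 : ℂ) 1 := mem_ball_self one_pos
  have h1 := (hK.differentiableOn.differentiableAt (isOpen_ball.mem_nhds (hm h0))).hasDerivAt
  have h2 := (hs.differentiableAt (isOpen_ball.mem_nhds h0)).hasDerivAt
  have h3 := h1.comp (0 : ℂ) h2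
  have h4 : HasDerivAt (fun x : ℂ => c + r * x) r 0 := by
    simpa using ((hasDerivAt_id (0 : ℂ)).const_mul (r : ℂ)).const_add c
  have h5 : K ∘ s =ᶠ[𝓝 0] fun x : ℂ => c + r * x := by
    filter_upwards [ball_mem_nhds (0 : ℂ) one_pos] with x hx using hsec x hx
  exact h3.unique (h4.congr_of_eventuallyEq h5)

lemma IsDiscLifting.deriv_ne_zero {K : ℂ → ℂ} {Ω : Set ℂ} (hK : IsDiscLifting K Ω)
    (hΩ : IsOpen Ω) {w : ℂ} (hw : w ∈ ball (0 : ℂ) 1) (hKw : K w ∈ Ω) : deriv K w ≠ 0 := by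
  obtain ⟨r, hr, hsub⟩ := Metric.isOpen_iff.1 hΩ _ hKw
  obtain ⟨s, hs, hm, rfl, hsec⟩ := hK.exists_section hw hr hsub
  have := hK.deriv_mul_deriv_section hs hm hsec
  intro h0
  rw [h0, zero_mul] at this
  exact hr.ne (by exact_mod_cast this)

/-- The inverse branch s through 0 has |s'(0)| ≤ 1 by Schwarz, while K'(0) s'(0) = r. This keeps the
infimum in the extremal problem positive. -/
lemma IsDiscLifting.le_norm_deriv {K : ℂ → ℂ} {Ω : Set ℂ} (hK : IsDiscLifting K Ω)
    {r : ℝ} (hr : 0 < r) (hsub : ball (K 0) r ⊆ Ω) : r ≤ ‖deriv K 0‖ := by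
  obtain ⟨s, hs, hm, hs0, hsec⟩ := hK.exists_section (mem_ball_self one_pos) hr hsub
  have h := hK.deriv_mul_deriv_section hs hm hsec
  rw [hs0] at h
  have h1 : ‖deriv s 0‖ ≤ 1 := Complex.norm_deriv_le_one_of_mapsTo_ball hs
    (by rw [hs0]; exact hm.mono_right ball_subset_closedBall) one_pos
  have h2 := congrArg norm h
  rw [norm_mul, Complex.norm_real, Real.norm_of_nonneg hr.le] at h2
  rw [← h2]
  exact mul_le_of_le_one_right (norm_nonneg _) h1

/-! ### Koebe's extremal construction of the covering -/

/-- The self-map of the disk, fixing `0`, that is a double cover branched exactly over `b ^ 2`. -/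
noncomputable def koebeMap (b z : ℂ) : ℂ := discSwap (b ^ 2) (discSwap b z ^ 2)

lemma sq_mem_ball {b : ℂ} (hb : b ∈ ball (0 : ℂ) 1) : b ^ 2 ∈ ball (0 : ℂ) 1 := by
  rw [mem_ball_zero_iff] at *
  rw [norm_pow]
  exact pow_lt_one₀ (norm_nonneg _) hb two_ne_zero

lemma koebeMap_mapsTo {b : ℂ} (hb : b ∈ ball (0 : ℂ) 1) :
    MapsTo (koebeMap b) (ball 0 1) (ball 0 1) :=
  fun _ hz => discSwap_mem (sq_mem_ball hb) (sq_mem_ball (discSwap_mem hb hz))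

@[simp] lemma koebeMap_zero (b : ℂ) : koebeMap b 0 = 0 := by simp [koebeMap]

lemma differentiableOn_koebeMap {b : ℂ} (hb : b ∈ ball (0 : ℂ) 1) :
    DifferentiableOn ℂ (koebeMap b) (ball 0 1) :=
  (differentiableOn_discSwap (sq_mem_ball hb)).comp ((differentiableOn_discSwap hb).pow 2)
    fun _ hz => sq_mem_ball (discSwap_mem hb hz)

lemma norm_deriv_koebeMap {b : ℂ} (hb : b ∈ ball (0 : ℂ) 1) :
    ‖deriv (koebeMap b) 0‖ = 2 * ‖b‖ / (1 + ‖b‖ ^ 2) := by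
  have h1 := hasDerivAt_discSwap hb (mem_ball_self one_pos)
  have h2 := h1.pow 2
  have hb2 := sq_mem_ball hb
  have h3 := hasDerivAt_discSwap hb2 (z := (discSwap b ^ 2) 0) (by simpa using hb2)
  have h4 := (h3.comp 0 h2).deriv
  have h5 : deriv (koebeMap b) 0 = _ := h4
  rw [h5]
  have hlt : ‖b‖ < 1 := by simpa using hb
  have hb0 := norm_nonneg b
  have hp : 0 < 1 - ‖b‖ ^ 2 := by nlinarith
  have e1 : (1 : ℂ) - conj (b ^ 2) * b ^ 2 = ((1 - ‖b‖ ^ 4 : ℝ) : ℂ) := by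
    rw [Complex.conj_mul', norm_pow]; push_cast; ring
  have e2 : (-(1 - ((‖b ^ 2‖ : ℝ) : ℂ) ^ 2)) = ((-(1 - ‖b‖ ^ 4) : ℝ) : ℂ) := by
    rw [norm_pow]; push_cast; ring
  have e3 : (-(1 - ((‖b‖ : ℝ) : ℂ) ^ 2)) = ((-(1 - ‖b‖ ^ 2) : ℝ) : ℂ) := by
    push_cast; ring
  simp only [Pi.pow_apply, discSwap_zero]
  rw [e1, e2, e3]
  have hp4 : 0 < 1 - ‖b‖ ^ 4 := by nlinarith
  simp only [norm_mul, norm_div, norm_pow, Complex.norm_real, Real.norm_eq_abs, abs_neg,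
    abs_of_pos hp, abs_of_pos hp4]
  norm_num
  field_simp
  ring

/-- Koebe's square root trick. -/
lemma IsDiscLifting.comp_koebeMap {K : ℂ → ℂ} {Ω : Set ℂ} (hK : IsDiscLifting K Ω) {b : ℂ}
    (hb : b ∈ ball (0 : ℂ) 1) (hKb : K (b ^ 2) ∉ Ω) : IsDiscLifting (K ∘ koebeMap b) Ω where
  differentiableOn :=
    hK.differentiableOn.comp (differentiableOn_koebeMap hb) (koebeMap_mapsTo hb)
  exists_lift g hg hgm w hw hwg := by
    have hb2 := sq_mem_ball hb
    obtain ⟨s, hs, hsm, hs0, hsg⟩ := hK.exists_lift g hg hgm _ (koebeMap_mapsTo hb hw) hwg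
    -- The lift s avoids the branch value b², since K(b²) is outside Ω; hence the square root in
    -- `koebeMap` can be inverted along s.
    have hne : ∀ x ∈ ball (0 : ℂ) 1, discSwap (b ^ 2) (s x) ≠ 0 := by
      intro x hx h0
      have h1 := discSwap_discSwap hb2 (hsm hx)
      rw [h0, discSwap_zero] at h1
      exact hKb (by rw [h1, hsg x hx]; exact hgm hx)
    obtain ⟨q, hq, hq0, hqs⟩ := exists_differentiableOn_sq_eq
      (h := discSwap (b ^ 2) ∘ s) ((differentiableOn_discSwap hb2).comp hs hsm) hne
      (b := discSwap b w) (by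
        rw [Function.comp_apply, hs0, koebeMap,
          discSwap_discSwap hb2 (sq_mem_ball (discSwap_mem hb hw))])
    have hqm : MapsTo q (ball 0 1) (ball 0 1) := by
      intro x hx
      have h1 := discSwap_mem hb2 (hsm hx)
      have h2 : q x ^ 2 = discSwap (b ^ 2) (s x) := hqs x hx
      rw [← h2, mem_ball_zero_iff, norm_pow] at h1
      rw [mem_ball_zero_iff]
      nlinarith [norm_nonneg (q x)]
    refine ⟨discSwap b ∘ q, (differentiableOn_discSwap hb).comp hq hqm,
      (discSwap_mapsTo hb).comp hqm, ?_, fun x hx => ?_⟩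
    · rw [Function.comp_apply, hq0, discSwap_discSwap hb hw]
    · rw [Function.comp_apply, Function.comp_apply, koebeMap, discSwap_discSwap hb (hqm hx),
        hqs x hx, Function.comp_apply, discSwap_discSwap hb2 (hsm hx), hsg x hx]

/-- Makes the family of competitors in the extremal problem nonempty. -/
lemma isDiscLifting_id {Ω : Set ℂ} (hΩ : Ω ⊆ ball 0 1) : IsDiscLifting id Ω where
  differentiableOn := differentiableOn_id
  exists_lift g hg hgm _ _ hwg := ⟨g, hg, hgm.mono_right hΩ, hwg.symm, fun _ _ => rfl⟩

lemma eventually_ne_of_deriv_ne_zero {G : ℂ → ℂ} (hG : DifferentiableOn ℂ G (ball 0 1))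
    (h0 : deriv G 0 ≠ 0) {w : ℂ} (hw : w ∈ ball (0 : ℂ) 1) : ∀ᶠ z in 𝓝[≠] w, G z ≠ G w := by
  have hA := hG.analyticOnNhd isOpen_ball
  refine ((hA w hw).eventually_eq_or_eventually_ne analyticAt_const).resolve_left fun hev => h0 ?_
  have heq := hA.eqOn_of_preconnected_of_eventuallyEq (g := fun _ => G w) analyticOnNhd_const
    (convex_ball 0 1).isPreconnected hw hev
  have : G =ᶠ[𝓝 0] fun _ => G w := heq.eventuallyEq_of_mem (ball_mem_nhds _ one_pos)
  rw [this.deriv_eq]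
  simp

/-- The lifting property passes to locally uniform limits. -/
lemma IsDiscLifting.of_tendstoLocallyUniformlyOn {𝒰 : Ultrafilter ℕ} (h𝒰 : ↑𝒰 ≤ (atTop : Filter ℕ))
    {K : ℕ → ℂ → ℂ} {G : ℂ → ℂ} {Ω : Set ℂ} (hK : ∀ n, IsDiscLifting (K n) Ω)
    (hG : DifferentiableOn ℂ G (ball 0 1)) (h0 : deriv G 0 ≠ 0)
    (hlim : TendstoLocallyUniformlyOn K G 𝒰 (ball 0 1)) : IsDiscLifting G Ω where
  differentiableOn := hG
  exists_lift g hg hgm w hw hwg := by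
    -- Lifting through K_n needs a base point exactly over g(0), whereas w lies over g(0) only for
    -- the limit; Hurwitz supplies base points x_n → w.
    obtain ⟨x, hxt, hx⟩ := exists_seq_tendsto_eq_of_tendstoLocallyUniformlyOn h𝒰
      (.of_forall fun n => (hK n).differentiableOn) hG hlim hw
      (eventually_ne_of_deriv_ne_zero hG h0 hw)
    have hlift : ∀ᶠ n in 𝒰, ∃ s : ℂ → ℂ, DifferentiableOn ℂ s (ball 0 1) ∧
        MapsTo s (ball 0 1) (ball 0 1) ∧ s 0 = x n ∧ ∀ y ∈ ball (0 : ℂ) 1, K n (s y) = g y :=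
      hx.mono fun n hn => (hK n).exists_lift g hg hgm (x n) hn.1 (hn.2.trans hwg)
    obtain ⟨s, hs⟩ := hlift.choice
    obtain ⟨S, hSlim, hSd, hSm⟩ := exists_tendstoLocallyUniformlyOn_of_ultrafilter 𝒰
      (hs.mono fun n hn => hn.1) (hs.mono fun n hn => hn.2.1.mono_right ball_subset_closedBall)
    have hpt : ∀ y ∈ ball (0 : ℂ) 1, Tendsto (fun n => s n y) 𝒰 (𝓝 (S y)) :=
      fun y hy => hSlim.tendsto_at hy
    have hS0 : S 0 = w := tendsto_nhds_unique (hpt 0 (mem_ball_self one_pos))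
      (hxt.congr' (hs.mono fun n hn => hn.2.2.1.symm))
    have hSb := mapsTo_ball_of_mapsTo_closedBall hSd hSm (by rwa [hS0])
    refine ⟨S, hSd, hSb, hS0, fun y hy => ?_⟩
    have hy' : S y ∈ ball (0 : ℂ) 1 := hSb hy
    have h1 := hlim.tendsto_comp (hG.continuousOn _ hy') hy'
      (tendsto_nhdsWithin_iff.2 ⟨hpt y hy, hs.mono fun n hn => hn.2.1 hy⟩)
    exact tendsto_nhds_unique h1
      (tendsto_const_nhds.congr' (hs.mono fun n hn => (hn.2.2.2 y hy).symm))

/-- A bounded domain is the image of the disk under a holomorphic map with the lifting property. -/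
theorem exists_isDiscLifting_of_subset_ball {Ω : Set ℂ} (hΩ : IsOpen Ω) (hsub : Ω ⊆ ball 0 1)
    (h0 : (0 : ℂ) ∈ Ω) :
    ∃ K : ℂ → ℂ, IsDiscLifting K Ω ∧ MapsTo K (ball 0 1) Ω ∧ K 0 = 0 := by
  obtain ⟨r, hr, hrΩ⟩ := Metric.isOpen_iff.1 hΩ 0 h0
  let 𝓕 : Set (ℂ → ℂ) := {K | IsDiscLifting K Ω ∧ MapsTo K (ball 0 1) (ball 0 1) ∧ K 0 = 0}
  let A : Set ℝ := (fun K => ‖deriv K 0‖) '' 𝓕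
  have hAne : A.Nonempty := ⟨_, id, ⟨isDiscLifting_id hsub, mapsTo_id _, rfl⟩, rfl⟩
  have hAr : ∀ t ∈ A, r ≤ t := by
    rintro _ ⟨K, hK, rfl⟩
    exact hK.1.le_norm_deriv hr (by rwa [hK.2.2])
  have hAbdd : BddBelow A := ⟨r, hAr⟩
  have hmr : r ≤ sInf A := le_csInf hAne hAr
  have hm : 0 < sInf A := hr.trans_le hmr
  obtain ⟨u, -, hut, huA⟩ := exists_seq_tendsto_sInf hAne hAbdd
  choose K hK hKu using huA
  have h𝒰 : ((hyperfilter ℕ : Ultrafilter ℕ) : Filter ℕ) ≤ atTop := by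
    rw [← Nat.cofinite_eq_atTop]; exact hyperfilter_le_cofinite
  obtain ⟨G, hlim, hGd, -⟩ := exists_tendstoLocallyUniformlyOn_of_ultrafilter (hyperfilter ℕ)
    (F := K) (.of_forall fun n => (hK n).1.differentiableOn)
    (.of_forall fun n => (hK n).2.1.mono_right ball_subset_closedBall)
  have hball : (0 : ℂ) ∈ ball (0 : ℂ) 1 := mem_ball_self one_pos
  have hG0 : G 0 = 0 := tendsto_nhds_unique (hlim.tendsto_at hball)
    (tendsto_const_nhds.congr fun n => (hK n).2.2.symm)
  have hder : ‖deriv G 0‖ = sInf A := by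
    have h1 := (hlim.deriv (.of_forall fun n => (hK n).1.differentiableOn)
      isOpen_ball).tendsto_at hball
    exact tendsto_nhds_unique h1.norm ((hut.mono_left h𝒰).congr fun n => (hKu n).symm)
  have hG1 : deriv G 0 ≠ 0 := norm_pos_iff.1 (hder ▸ hm)
  -- Near the minimum no value outside Ω can occur on |a| ≤ ρ: composing with `koebeMap` would
  -- multiply the derivative by at most κ < 1 and go below the infimum.
  have hin : ∀ ρ : ℝ, 0 < ρ → ρ < 1 → ∀ᶠ n in hyperfilter ℕ, ∀ a : ℂ, ‖a‖ ≤ ρ → K n a ∈ Ω := by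
    intro ρ hρ hρ1
    have hs1 : √ρ < 1 := by rw [Real.sqrt_lt' one_pos]; simpa
    -- With t = |b| ≤ √ρ one has 1 - 2t/(1 + t²) = (1 - t)²/(1 + t²) ≥ (1 - √ρ)²/2.
    set κ := 1 - (1 - √ρ) ^ 2 / 2 with hκ
    have hκ1 : κ < 1 := by
      have : 0 < (1 - √ρ) ^ 2 := by have := sub_pos.2 hs1; positivity
      linarith
    have hκ0 : 0 < κ := by nlinarith [Real.sqrt_nonneg ρ]
    have hlt : sInf A < sInf A / κ := by rw [lt_div_iff₀ hκ0]; nlinarith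
    filter_upwards [(hut.mono_left h𝒰).eventually (gt_mem_nhds hlt)] with n hn a ha
    by_contra hnot
    obtain ⟨b, rfl⟩ : ∃ b : ℂ, b ^ 2 = a := IsAlgClosed.exists_pow_nat_eq a two_pos
    rw [norm_pow] at ha
    have hbs : ‖b‖ ≤ √ρ := Real.le_sqrt_of_sq_le ha
    have hb : b ∈ ball (0 : ℂ) 1 := by simpa using hbs.trans_lt hs1
    have hmem : ‖deriv (K n ∘ koebeMap b) 0‖ ∈ A :=
      ⟨_, ⟨(hK n).1.comp_koebeMap hb hnot, (hK n).2.1.comp (koebeMap_mapsTo hb),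
        by simp [(hK n).2.2]⟩, rfl⟩
    have hle := csInf_le hAbdd hmem
    have hd1 : DifferentiableAt ℂ (koebeMap b) 0 :=
      (differentiableOn_koebeMap hb).differentiableAt (isOpen_ball.mem_nhds hball)
    have hd2 : DifferentiableAt ℂ (K n) (koebeMap b 0) := by
      rw [koebeMap_zero]
      exact (hK n).1.differentiableOn.differentiableAt (isOpen_ball.mem_nhds hball)
    rw [deriv_comp (0 : ℂ) hd2 hd1, norm_mul, norm_deriv_koebeMap hb, koebeMap_zero] at hle
    have hku : ‖deriv (K n) 0‖ = u n := hKu n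
    rw [hku] at hle
    have hb0 := norm_nonneg b
    have hk : 2 * ‖b‖ / (1 + ‖b‖ ^ 2) ≤ κ := by
      rw [div_le_iff₀ (by positivity)]
      have h1 : (1 - √ρ) ^ 2 ≤ (1 - ‖b‖) ^ 2 := by
        apply pow_le_pow_left₀ <;> linarith
      nlinarith [mul_nonneg (sq_nonneg (1 - √ρ)) (show 0 ≤ 1 - ‖b‖ ^ 2 by nlinarith)]
    have hun : 0 ≤ u n := hku ▸ norm_nonneg _
    rw [lt_div_iff₀ hκ0] at hn
    nlinarith [mul_le_mul_of_nonneg_left hk hun]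
  refine ⟨G, .of_tendstoLocallyUniformlyOn h𝒰 (fun n => (hK n).1) hGd hG1 hlim, ?_, hG0⟩
  intro x hx
  by_contra hnot
  have hx1 : ‖x‖ < 1 := by simpa using hx
  -- A limit of points of Ω need only lie in its closure; by Hurwitz, G(x) is itself a value K_n(y)
  -- with |y| ≤ (1 + |x|)/2, hence in Ω.
  have h1 := eventually_exists_eq_of_tendstoLocallyUniformlyOn
    (.of_forall fun n => (hK n).1.differentiableOn) hGd hlim hx
    (eventually_ne_of_deriv_ne_zero hGd hG1 hx) (ρ := (1 - ‖x‖) / 2) (by linarith)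
  obtain ⟨n, ⟨y, -, hyx, hy⟩, hn⟩ := (h1.and
    (hin ((1 + ‖x‖) / 2) (by linarith [norm_nonneg x]) (by linarith))).exists
  refine hnot (hy ▸ hn y ?_)
  have h2 : ‖y‖ ≤ ‖x‖ + dist y x := by
    rw [dist_eq_norm]; simpa using norm_add_le x (y - x)
  linarith

/-- A plane domain whose complement has interior is the target of a holomorphic map from the disk
with the lifting property. -/
theorem exists_isDiscLifting {U : Set ℂ} (hU : IsOpen U) {a : ℂ} {ε : ℝ} (hε : 0 < ε)
    (hdisj : ∀ x ∈ U, ε ≤ ‖x - a‖) {z : ℂ} (hz : z ∈ U) :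
    ∃ π : ℂ → ℂ, IsDiscLifting π U ∧ MapsTo π (ball 0 1) U ∧ π 0 = z := by
  have hne : ∀ x ∈ U, x - a ≠ 0 := fun x hx => norm_pos_iff.1 (hε.trans_le (hdisj x hx))
  have hc : ((ε / 3 : ℝ) : ℂ) ≠ 0 := by exact_mod_cast (by positivity : ε / 3 ≠ 0)
  set c : ℂ := ((ε / 3 : ℝ) : ℂ) with hcdef
  have hcn : ‖c‖ = ε / 3 := by
    rw [hcdef, Complex.norm_real, Real.norm_of_nonneg (by positivity)]
  set k : ℂ := c / (z - a) with hk
  have hk0 : k ≠ 0 := div_ne_zero hc (hne z hz)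
  -- An inversion about the omitted disk: both terms have modulus at most 1/3 on U, so the image
  -- lies in the unit disk, and k is chosen so that z goes to 0.
  let m : ℂ → ℂ := fun x => c / (x - a) - k
  let p : ℂ → ℂ := fun y => a + c / (y + k)
  have hbound : ∀ x ∈ U, ‖c / (x - a)‖ ≤ 1 / 3 := by
    intro x hx
    rw [norm_div, hcn, div_le_iff₀ (hε.trans_le (hdisj x hx))]
    linarith [hdisj x hx]
  let Ω : Set ℂ := {y | y + k ≠ 0} ∩ p ⁻¹' U
  have hpm : ∀ x ∈ U, p (m x) = x := by
    intro x hx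
    have := hne x hx
    simp only [p, m, sub_add_cancel]
    field_simp
    ring
  have hmp : ∀ y ∈ Ω, m (p y) = y := by
    intro y hy
    have : y + k ≠ 0 := hy.1
    simp only [p, m, add_sub_cancel_left]
    field_simp
    ring
  have hmΩ : MapsTo m U Ω := fun x hx =>
    ⟨by simpa [m] using div_ne_zero hc (hne x hx), by rw [mem_preimage, hpm x hx]; exact hx⟩
  have hpd : DifferentiableOn ℂ p {y | y + k ≠ 0} := by
    intro y hy
    exact ((differentiableAt_const _).add ((differentiableAt_const _).div
      (differentiableAt_id.add_const k) hy)).differentiableWithinAt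
  have hmd : DifferentiableOn ℂ m U := by
    intro y hy
    exact (((differentiableAt_const _).div
      (differentiableAt_id.sub_const a) (hne y hy)).sub_const k).differentiableWithinAt
  have hΩo : IsOpen Ω := hpd.continuousOn.isOpen_inter_preimage
    (isOpen_ne_fun (by fun_prop) (by fun_prop)) hU
  have hΩb : Ω ⊆ ball 0 1 := by
    intro y hy
    rw [mem_ball_zero_iff, ← hmp y hy]
    have h1 := norm_sub_le (c / (p y - a)) k
    have h2 := hbound _ hy.2
    have h3 := hbound z hz
    exact (h1.trans (add_le_add h2 h3)).trans_lt (by norm_num)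
  have h0 : (0 : ℂ) ∈ Ω := by
    have : m z = 0 := by simp [m, hk]
    exact this ▸ hmΩ hz
  obtain ⟨K, hK, hKm, hK0⟩ := exists_isDiscLifting_of_subset_ball hΩo hΩb h0
  refine ⟨p ∘ K, ⟨?_, ?_⟩, fun x hx => (hKm hx).2, ?_⟩
  · exact hpd.comp hK.differentiableOn fun x hx => (hKm hx).1
  · intro g hg hgm w hw hwg
    obtain ⟨s, hs, hsm, hs0, hsg⟩ := hK.exists_lift (m ∘ g) (hmd.comp hg hgm) (hmΩ.comp hgm) w hw
      (by rw [Function.comp_apply, ← hwg, Function.comp_apply, hmp _ (hKm hw)])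
    refine ⟨s, hs, hsm, hs0, fun x hx => ?_⟩
    rw [Function.comp_apply, hsg x hx, Function.comp_apply, hpm _ (hgm hx)]
  · have : m z = 0 := by simp [m, hk]
    rw [Function.comp_apply, hK0, ← this, hpm z hz]

/-! ### From the lifting property to covering maps -/

lemma IsDiscLifting.exists_injOn {π : ℂ → ℂ} {U : Set ℂ} (hπ : IsDiscLifting π U)
    (hm : MapsTo π (ball 0 1) U) (hU : IsOpen U) {w : ℂ} (hw : w ∈ ball (0 : ℂ) 1) :
    ∃ δ > 0, InjOn π (ball w δ) := by
  have hA := (hπ.differentiableOn.analyticOnNhd isOpen_ball w hw).hasStrictDerivAt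
  have hne := hπ.deriv_ne_zero hU hw (hm hw)
  obtain ⟨δ, hδ, h⟩ := Metric.eventually_nhds_iff_ball.1 (hA.eventually_left_inverse hne)
  exact ⟨δ, hδ, fun x hx y hy hxy => by rw [← h x hx, ← h y hy, hxy]⟩

/-- Lifts are determined by one value. -/
lemma IsDiscLifting.eqOn_of_comp_eqOn {π : ℂ → ℂ} {U : Set ℂ} (hπ : IsDiscLifting π U)
    (hm : MapsTo π (ball 0 1) U) (hU : IsOpen U) {s t : ℂ → ℂ}
    (hs : DifferentiableOn ℂ s (ball 0 1)) (hsm : MapsTo s (ball 0 1) (ball 0 1))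
    (ht : DifferentiableOn ℂ t (ball 0 1))
    (hst : ∀ x ∈ ball (0 : ℂ) 1, π (s x) = π (t x)) {x : ℂ} (hx : x ∈ ball (0 : ℂ) 1)
    (hxe : s x = t x) : EqOn s t (ball 0 1) := by
  obtain ⟨δ, hδ, hinj⟩ := hπ.exists_injOn hm hU (hsm hx)
  have hsc : ContinuousAt s x := hs.continuousOn.continuousAt (isOpen_ball.mem_nhds hx)
  have htc : ContinuousAt t x := ht.continuousOn.continuousAt (isOpen_ball.mem_nhds hx)
  refine (hs.analyticOnNhd isOpen_ball).eqOn_of_preconnected_of_eventuallyEq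
    (ht.analyticOnNhd isOpen_ball) (convex_ball 0 1).isPreconnected hx ?_
  filter_upwards [hsc.eventually_mem (ball_mem_nhds _ hδ),
    htc.eventually_mem (ball_mem_nhds _ hδ), isOpen_ball.mem_nhds hx] with y h1 h2 hy
  exact hinj h1 (by rw [hxe]; exact h2) (hst y hy)

/-- Inverse branches make the image open and relatively closed in the connected set U. -/
lemma IsDiscLifting.image_eq {π : ℂ → ℂ} {U : Set ℂ} (hπ : IsDiscLifting π U)
    (hm : MapsTo π (ball 0 1) U) (hU : IsOpen U) (hc : IsPreconnected U) :
    π '' ball 0 1 = U := by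
  have hball : ∀ w ∈ ball (0 : ℂ) 1, ∀ r > 0, ball (π w) r ⊆ U →
      ball (π w) r ⊆ π '' ball 0 1 := by
    intro w hw r hr hsub y hy
    obtain ⟨s, -, hsm, -, hsec⟩ := hπ.exists_section hw hr hsub
    have hx : (y - π w) / r ∈ ball (0 : ℂ) 1 := by
      rw [mem_ball, dist_eq_norm] at hy
      rw [mem_ball_zero_iff, norm_div, Complex.norm_real, Real.norm_of_nonneg hr.le]
      exact (div_lt_one hr).2 hy
    refine ⟨s _, hsm hx, ?_⟩
    rw [hsec _ hx, mul_div_cancel₀ _ (by exact_mod_cast hr.ne'), add_sub_cancel]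
  refine Subset.antisymm hm.image_subset (hc.subset_of_closure_inter_subset ?_ ?_ ?_)
  · rw [Metric.isOpen_iff]
    rintro _ ⟨w, hw, rfl⟩
    obtain ⟨r, hr, hsub⟩ := Metric.isOpen_iff.1 hU _ (hm hw)
    exact ⟨r, hr, hball w hw r hr hsub⟩
  · have h0 : (0 : ℂ) ∈ ball (0 : ℂ) 1 := mem_ball_self one_pos
    exact ⟨π 0, hm h0, 0, h0, rfl⟩
  · rintro z ⟨hz, hzU⟩
    obtain ⟨r, hr, hsub⟩ := Metric.isOpen_iff.1 hU _ hzU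
    obtain ⟨_, ⟨w, hw, rfl⟩, hd⟩ := Metric.mem_closure_iff.1 hz (r / 2) (half_pos hr)
    refine hball w hw (r / 2) (half_pos hr) ((ball_subset_ball' ?_).trans hsub) hd
    rw [dist_comm]; linarith

/-- The sheets over a small disk about z are the images of the inverse branches through the points
of the fibre over z. -/
lemma IsDiscLifting.isCoveringMapOn {π : ℂ → ℂ} {U : Set ℂ} (hπ : IsDiscLifting π U)
    (hm : MapsTo π (ball 0 1) U) (hU : IsOpen U) (hc : IsPreconnected U) :
    IsCoveringMapOn (fun w : ball (0 : ℂ) 1 => π w) U := by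
  intro z hz
  obtain ⟨R, hR, hRU⟩ := Metric.isOpen_iff.1 hU _ hz
  -- For π(w) within ρ of z, the disk of radius 2ρ about π(w) stays in U and contains the ρ-disk
  -- about z. The branch through w therefore reaches the fibre over z, which identifies the sheet of
  -- w.
  obtain ⟨ρ, hρ, rfl⟩ : ∃ ρ > 0, R = 3 * ρ := ⟨R / 3, by positivity, by ring⟩
  have hρ0 : (ρ : ℂ) ≠ 0 := by exact_mod_cast hρ.ne'
  have hsub1 : ball z ρ ⊆ U := (ball_subset_ball (by linarith)).trans hRU
  let ι := {w : ball (0 : ℂ) 1 // π w = z}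
  let : TopologicalSpace ι := ⊥
  have : DiscreteTopology ι := ⟨rfl⟩
  obtain ⟨w₀, hw₀, hw₀z⟩ := (hπ.image_eq hm hU hc).symm ▸ hz
  have : Nonempty ι := ⟨⟨⟨w₀, hw₀⟩, hw₀z⟩⟩
  have : Nonempty (ℂ → ball (0 : ℂ) 1) := ⟨fun _ => ⟨w₀, hw₀⟩⟩
  have hsecs : ∀ i : ι, ∃ s : ℂ → ℂ, DifferentiableOn ℂ s (ball 0 1) ∧
      MapsTo s (ball 0 1) (ball 0 1) ∧ s 0 = (i.1 : ℂ) ∧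
      ∀ x ∈ ball (0 : ℂ) 1, π (s x) = z + ρ * x := by
    intro i
    have := hπ.exists_section i.1.2 hρ (by rw [i.2]; exact hsub1)
    rwa [i.2] at this
  choose s hs hsm hs0 hsec using hsecs
  have hxmem : ∀ {r : ℝ} {y c : ℂ}, 0 < r → y ∈ ball c r → (y - c) / r ∈ ball (0 : ℂ) 1 := by
    intro r y c hr hy
    rw [mem_ball, dist_eq_norm] at hy
    rw [mem_ball_zero_iff, norm_div, Complex.norm_real, Real.norm_of_nonneg hr.le]
    exact (div_lt_one hr).2 hy
  have hsecy : ∀ i, ∀ y ∈ ball z ρ, π (s i ((y - z) / ρ)) = y := by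
    intro i y hy
    rw [hsec i _ (hxmem hρ hy), mul_div_cancel₀ _ hρ0, add_sub_cancel]
  let S : ι → Set (ball (0 : ℂ) 1) := fun i => Subtype.val ⁻¹' (s i '' ball 0 1)
  have hinj0 : ∀ i j, ∀ x ∈ ball (0 : ℂ) 1, ∀ y ∈ ball (0 : ℂ) 1, π (s i x) = π (s j y) →
      x = y := by
    intro i j x hx y hy h
    rw [hsec i x hx, hsec j y hy] at h
    exact mul_left_cancel₀ hρ0 (add_left_cancel h)
  have hSopen : ∀ i, IsOpen (S i) := by
    intro i
    refine IsOpen.preimage continuous_subtype_val ?_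
    refine (((hs i).analyticOnNhd isOpen_ball).is_constant_or_isOpen
      (convex_ball 0 1).isPreconnected).resolve_left ?_ _ Subset.rfl isOpen_ball
    rintro ⟨c, hconst⟩
    have h0 : (0 : ℂ) ∈ ball (0 : ℂ) 1 := mem_ball_self one_pos
    have h1 : (1 / 2 : ℂ) ∈ ball (0 : ℂ) 1 := by
      rw [mem_ball_zero_iff]; norm_num
    have := hinj0 i i _ h0 _ h1 (by rw [hconst _ h0, hconst _ h1])
    norm_num at this
  have hcont : Continuous fun w : ball (0 : ℂ) 1 => π w :=
    continuousOn_iff_continuous_domRestrict.1 hπ.differentiableOn.continuousOn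
  have hopeniff : ∀ i {W : Set ℂ}, W ⊆ ball z ρ →
      (IsOpen W ↔ IsOpen ((fun w : ball (0 : ℂ) 1 => π w) ⁻¹' W ∩ S i)) := by
    intro i W hW
    refine ⟨fun h => (h.preimage hcont).inter (hSopen i), fun h => ?_⟩
    obtain ⟨O, hO, hOe⟩ := isOpen_induced_iff.1 h
    have hcs : ContinuousOn (fun y => s i ((y - z) / ρ)) (ball z ρ) :=
      (hs i).continuousOn.comp (by fun_prop) fun y hy => hxmem hρ hy
    have hWe : W = ball z ρ ∩ (fun y => s i ((y - z) / ρ)) ⁻¹' O := by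
      ext y
      have hmemiff : y ∈ ball z ρ → (s i ((y - z) / ρ) ∈ O ↔ y ∈ W) := by
        intro hy
        have hx := hxmem hρ hy
        have h1 := Set.ext_iff.1 hOe (⟨s i ((y - z) / ρ), hsm i hx⟩ : ball (0 : ℂ) 1)
        have h2 : (⟨s i ((y - z) / ρ), hsm i hx⟩ : ball (0 : ℂ) 1) ∈ S i := ⟨_, hx, rfl⟩
        simpa only [mem_inter_iff, mem_preimage, hsecy i y hy, and_iff_left h2] using h1
      exact ⟨fun hy => ⟨hW hy, (hmemiff (hW hy)).2 hy⟩, fun hy => (hmemiff hy.1).1 hy.2⟩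
    rw [hWe]
    exact hcs.isOpen_inter_preimage isOpen_ball hO
  have hinj : ∀ i, InjOn (fun w : ball (0 : ℂ) 1 => π w) (S i) := by
    rintro i ⟨_, _⟩ ⟨x, hx, rfl⟩ ⟨_, _⟩ ⟨y, hy, rfl⟩ h
    obtain rfl := hinj0 i i x hx y hy h
    rfl
  have hsurj : ∀ i, SurjOn (fun w : ball (0 : ℂ) 1 => π w) (S i) (ball z ρ) := by
    intro i y hy
    exact ⟨⟨s i ((y - z) / ρ), hsm i (hxmem hρ hy)⟩, ⟨_, hxmem hρ hy, rfl⟩, hsecy i y hy⟩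
  have hdisj : Pairwise (Function.onFun Disjoint S) := by
    intro i j hij
    refine Set.disjoint_left.2 ?_
    rintro ⟨_, _⟩ ⟨x, hx, rfl⟩ ⟨y, hy, hxy⟩
    refine hij ?_
    obtain rfl := hinj0 j i y hy x hx (congrArg π hxy)
    have := hπ.eqOn_of_comp_eqOn hm hU (hs i) (hsm i) (hs j)
      (fun v hv => by rw [hsec i v hv, hsec j v hv]) hx hxy.symm (mem_ball_self one_pos)
    rw [hs0, hs0] at this
    exact Subtype.ext (Subtype.ext this)
  have hexh : (fun w : ball (0 : ℂ) 1 => π w) ⁻¹' ball z ρ ⊆ ⋃ i, S i := by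
    rintro ⟨w, hw⟩ hwz
    have hwz' : π w ∈ ball z ρ := hwz
    have hd : dist (π w) z < ρ := hwz'
    have hsub2 : ball (π w) (2 * ρ) ⊆ U :=
      (ball_subset_ball' (by linarith)).trans hRU
    obtain ⟨t, ht, htm, ht0, htsec⟩ := hπ.exists_section hw (by positivity : 0 < 2 * ρ) hsub2
    have hmapρ : ∀ x ∈ ball (0 : ℂ) 1,
        (z + ρ * x - π w) / (2 * ρ : ℝ) ∈ ball (0 : ℂ) 1 := by
      intro x hx
      refine hxmem (by positivity) ?_
      rw [mem_ball_zero_iff] at hx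
      rw [mem_ball, dist_eq_norm]
      have h1 : z + ρ * x - π w = (ρ * x) - (π w - z) := by ring
      rw [h1]
      refine (norm_sub_le _ _).trans_lt ?_
      rw [norm_mul, Complex.norm_real, Real.norm_of_nonneg hρ.le, ← dist_eq_norm]
      nlinarith
    have h2ρ : ((2 * ρ : ℝ) : ℂ) ≠ 0 := by exact_mod_cast (by positivity : 2 * ρ ≠ 0)
    have htz : ∀ x ∈ ball (0 : ℂ) 1, π (t ((z + ρ * x - π w) / (2 * ρ : ℝ))) = z + ρ * x := by
      intro x hx
      rw [htsec _ (hmapρ x hx), mul_div_cancel₀ _ h2ρ, add_sub_cancel]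
    have h0 : (0 : ℂ) ∈ ball (0 : ℂ) 1 := mem_ball_self one_pos
    let i : ι := ⟨⟨_, htm (hmapρ 0 h0)⟩, by
      show π (t _) = z
      rw [htz 0 h0]; simp⟩
    have heq := hπ.eqOn_of_comp_eqOn hm hU (hs i) (hsm i)
      (t := fun x => t ((z + ρ * x - π w) / (2 * ρ : ℝ)))
      (ht.comp (by fun_prop) hmapρ)
      (fun x hx => by rw [hsec i x hx, htz x hx]) h0 (hs0 i)
    refine mem_iUnion.2 ⟨i, (π w - z) / ρ, hxmem hρ hwz', ?_⟩
    rw [heq (hxmem hρ hwz')]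
    show t _ = w
    rw [mul_div_cancel₀ _ hρ0, ← ht0]
    congr 1
    rw [ht0]
    simp
  exact (IsEvenlyCovered.of_trivialization
    (t := IsOpen.trivializationDiscrete S (ball z ρ) isOpen_ball hopeniff hinj hsurj hdisj hexh)
    (mem_ball_self hρ)).to_isEvenlyCovered_preimage

theorem IsDiscLifting.isDiskCovering {π : ℂ → ℂ} {U : Set ℂ} (hπ : IsDiscLifting π U)
    (hm : MapsTo π (ball 0 1) U) (hU : IsOpen U) (hc : IsPreconnected U) : IsDiskCovering π U :=
  ⟨hπ.differentiableOn, hπ.image_eq hm hU hc, hπ.isCoveringMapOn hm hU hc⟩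

/-- Allows any point of the disk to be moved to the centre, where the distance formula and
distortion are computed. -/
lemma IsDiscLifting.comp_discSwap {π : ℂ → ℂ} {U : Set ℂ} (hπ : IsDiscLifting π U) {a : ℂ}
    (ha : a ∈ ball (0 : ℂ) 1) : IsDiscLifting (π ∘ discSwap a) U where
  differentiableOn := hπ.differentiableOn.comp (differentiableOn_discSwap ha) (discSwap_mapsTo ha)
  exists_lift g hg hgm w hw hwg := by
    obtain ⟨s, hs, hsm, hs0, hsg⟩ := hπ.exists_lift g hg hgm _ (discSwap_mem ha hw) hwg
    refine ⟨discSwap a ∘ s, (differentiableOn_discSwap ha).comp hs hsm,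
      (discSwap_mapsTo ha).comp hsm, ?_, fun x hx => ?_⟩
    · rw [Function.comp_apply, hs0, discSwap_discSwap ha hw]
    · rw [Function.comp_apply, Function.comp_apply, discSwap_discSwap ha (hsm hx), hsg x hx]

/-! ### Hyperbolic distance and distortion -/

/-- The hyperbolic distance from the origin, as a function of the absolute value. -/
noncomputable def hypLog (t : ℝ) : ℝ := Real.log ((1 + t) / (1 - t))

lemma diskDist_eq_hypLog (w w' : ℂ) : diskDist w w' = hypLog ‖discSwap w w'‖ := by
  rw [diskDist, hypLog, norm_discSwap]

lemma hypLog_mono {s t : ℝ} (hs : 0 ≤ s) (hst : s ≤ t) (ht : t < 1) : hypLog s ≤ hypLog t := by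
  refine Real.log_le_log (div_pos (by linarith) (by linarith)) ?_
  exact div_le_div₀ (by linarith) (by linarith) (by linarith) (by linarith)

lemma hypLog_zero : hypLog 0 = 0 := by simp [hypLog]

lemma hypLog_nonneg {t : ℝ} (h0 : 0 ≤ t) (h1 : t < 1) : 0 ≤ hypLog t :=
  hypLog_zero ▸ hypLog_mono le_rfl h0 h1

lemma hypLog_le {t : ℝ} (h0 : 0 ≤ t) (h1 : t < 1) : hypLog t ≤ 2 * t / (1 - t) := by
  have h2 : 0 < 1 - t := by linarith
  refine (Real.log_le_sub_one_of_pos (div_pos (by linarith) h2)).trans_eq ?_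
  field_simp
  ring

lemma hasDerivAt_hypLog_zero : HasDerivAt hypLog 2 0 := by
  have h1 : HasDerivAt (fun t : ℝ => (1 + t) / (1 - t)) 2 0 := by
    have := ((hasDerivAt_id (0 : ℝ)).const_add 1).div ((hasDerivAt_id (0 : ℝ)).const_sub 1)
      (by simp)
    refine this.congr_deriv ?_
    norm_num
  refine (h1.log (by simp)).congr_deriv ?_
  norm_num

lemma diskDist_nonneg {w w' : ℂ} (hw : w ∈ ball (0 : ℂ) 1) (hw' : w' ∈ ball (0 : ℂ) 1) :
    0 ≤ diskDist w w' := by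
  rw [diskDist_eq_hypLog]
  exact hypLog_nonneg (norm_nonneg _) (by simpa using discSwap_mem hw hw')

lemma hypDist_nonneg (U : Set ℂ) (z z' : ℂ) : 0 ≤ hypDist U z z' := by
  refine Real.sInf_nonneg ?_
  rintro _ ⟨π, -, w, hw, w', hw', -, -, rfl⟩
  exact diskDist_nonneg hw hw'

lemma IsDiskCovering.hypDist_le {π : ℂ → ℂ} {U : Set ℂ} (hπ : IsDiskCovering π U) {w w' : ℂ}
    (hw : w ∈ ball (0 : ℂ) 1) (hw' : w' ∈ ball (0 : ℂ) 1) :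
    hypDist U (π w) (π w') ≤ diskDist w w' := by
  refine csInf_le ⟨0, ?_⟩ ⟨π, hπ, w, hw, w', hw', rfl, rfl, rfl⟩
  rintro _ ⟨π, -, w, hw, w', hw', -, -, rfl⟩
  exact diskDist_nonneg hw hw'

/-- Any competing covering lifts through π to a self-map of the disk fixing 0, so Schwarz bounds the
competing distance below by that of some preimage of π(v). Near 0, v is the preimage closest to 0,
by local injectivity. -/
lemma IsDiscLifting.exists_hypDist_eq {π : ℂ → ℂ} {U : Set ℂ} (hπ : IsDiscLifting π U)
    (hm : MapsTo π (ball 0 1) U) (hU : IsOpen U) (hc : IsPreconnected U) :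
    ∃ δ > 0, ∀ v ∈ ball (0 : ℂ) δ, hypDist U (π v) (π 0) = hypLog ‖v‖ := by
  have h0 : (0 : ℂ) ∈ ball (0 : ℂ) 1 := mem_ball_self one_pos
  have hcov := hπ.isDiskCovering hm hU hc
  obtain ⟨δ, hδ, hinj⟩ := hπ.exists_injOn hm hU h0
  refine ⟨min δ 1, by positivity, fun v hv => ?_⟩
  have hvδ : v ∈ ball (0 : ℂ) δ := ball_subset_ball (min_le_left _ _) hv
  have hv1 : v ∈ ball (0 : ℂ) 1 := ball_subset_ball (min_le_right _ _) hv
  have hd : diskDist v 0 = hypLog ‖v‖ := by rw [diskDist_eq_hypLog, discSwap_zero]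
  refine le_antisymm (hd ▸ hcov.hypDist_le hv1 h0) ?_
  refine le_csInf ⟨_, π, hcov, v, hv1, 0, h0, rfl, rfl, rfl⟩ ?_
  rintro _ ⟨ϖ, hϖ, u, hu, u', hu', huv, hu0, rfl⟩
  have hϖm : MapsTo ϖ (ball 0 1) U := fun x hx => hϖ.image_eq ▸ mem_image_of_mem ϖ hx
  obtain ⟨s, hs, hsm, hs0, hsg⟩ := hπ.exists_lift (ϖ ∘ discSwap u')
    (hϖ.holo.comp (differentiableOn_discSwap hu') (discSwap_mapsTo hu'))
    (hϖm.comp (discSwap_mapsTo hu')) 0 h0 (by simp [hu0])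
  have hx := discSwap_mem hu' hu
  have hsx : π (s (discSwap u' u)) = π v := by
    rw [hsg _ hx, Function.comp_apply, discSwap_discSwap hu' hu, huv]
  have hle : ‖s (discSwap u' u)‖ ≤ ‖discSwap u' u‖ :=
    Complex.norm_le_norm_of_mapsTo_ball hs (hsm.mono_right ball_subset_closedBall) hs0
      (mem_ball_zero_iff.1 hx)
  have hvle : ‖v‖ ≤ ‖s (discSwap u' u)‖ := by
    by_cases hsδ : s (discSwap u' u) ∈ ball (0 : ℂ) δ
    · rw [hinj hsδ hvδ hsx]
    · rw [mem_ball_zero_iff] at hsδ hvδ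
      linarith
  rw [diskDist_eq_hypLog, norm_discSwap_comm]
  exact hypLog_mono (norm_nonneg _) (hvle.trans hle) (mem_ball_zero_iff.1 hx)

/-- Since `hypLog` t ~ 2t at 0, the quotient behaves like |F(v)|/|v|. -/
lemma tendsto_hypLog_div {F : ℂ → ℂ} (hF : DifferentiableAt ℂ F 0) (h0 : F 0 = 0) :
    Tendsto (fun v => hypLog ‖F v‖ / hypLog ‖v‖) (𝓝[≠] 0) (𝓝 ‖deriv F 0‖) := by
  have hcont : ContinuousAt (dslope hypLog 0) 0 :=
    continuousAt_dslope_same.2 hasDerivAt_hypLog_zero.differentiableAt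
  have hval : dslope hypLog 0 0 = 2 := by rw [dslope_same, hasDerivAt_hypLog_zero.deriv]
  have hmul : ∀ t, hypLog t = t * dslope hypLog 0 t := by
    intro t
    have := sub_smul_dslope hypLog 0 t
    simp only [sub_zero, hypLog_zero, smul_eq_mul] at this
    exact this.symm
  have hslope : Tendsto (fun v => ‖F v‖ / ‖v‖) (𝓝[≠] 0) (𝓝 ‖deriv F 0‖) := by
    have := (hasDerivAt_iff_tendsto_slope.1 hF.hasDerivAt).norm
    refine this.congr fun v => ?_
    rw [slope_def_field, h0, sub_zero, sub_zero, norm_div]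
  have hFv : Tendsto (fun v => ‖F v‖) (𝓝[≠] 0) (𝓝 0) := by
    have := hF.continuousAt.norm.tendsto
    rw [h0, norm_zero] at this
    exact this.mono_left nhdsWithin_le_nhds
  have hv : Tendsto (fun v : ℂ => ‖v‖) (𝓝[≠] 0) (𝓝 0) := by
    have := (continuous_norm (E := ℂ)).tendsto 0
    rw [norm_zero] at this
    exact this.mono_left nhdsWithin_le_nhds
  have h1 := (hcont.tendsto.comp hFv).div (hcont.tendsto.comp hv) (by rw [hval]; norm_num)
  have h2 := hslope.mul h1
  rw [hval, div_self two_ne_zero, mul_one] at h2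
  refine h2.congr fun v => ?_
  rw [hmul ‖F v‖, hmul ‖v‖]
  simp only [Function.comp_apply, Pi.div_apply]
  rw [div_mul_div_comm]

/-- The hyperbolic distortion is the absolute value of the derivative of a lift to the disk. -/
theorem tendsto_hypQuotient {f π ϖ F : ℂ → ℂ} {U V : Set ℂ} (hπ : IsDiscLifting π U)
    (hπm : MapsTo π (ball 0 1) U) (hU : IsOpen U) (hUc : IsPreconnected U)
    (hϖ : IsDiscLifting ϖ V) (hϖm : MapsTo ϖ (ball 0 1) V) (hV : IsOpen V)
    (hVc : IsPreconnected V) (hF : DifferentiableOn ℂ F (ball 0 1)) (hF0 : F 0 = 0)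
    (hcomm : ∀ w ∈ ball (0 : ℂ) 1, ϖ (F w) = f (π w)) :
    Tendsto (hypQuotient f U V (π 0)) (𝓝[≠] (π 0)) (𝓝 ‖deriv F 0‖) := by
  have h0 : (0 : ℂ) ∈ ball (0 : ℂ) 1 := mem_ball_self one_pos
  obtain ⟨δ, hδ, hδe⟩ := hπ.exists_hypDist_eq hπm hU hUc
  obtain ⟨η, hη, hηe⟩ := hϖ.exists_hypDist_eq hϖm hV hVc
  have hFd : DifferentiableAt ℂ F 0 := hF.differentiableAt (isOpen_ball.mem_nhds h0)
  have hQ : Tendsto (fun v => hypQuotient f U V (π 0) (π v)) (𝓝[≠] 0) (𝓝 ‖deriv F 0‖) := by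
    refine (tendsto_hypLog_div hFd hF0).congr' ?_
    have h1 : ∀ᶠ v in 𝓝 (0 : ℂ), F v ∈ ball (0 : ℂ) η :=
      hFd.continuousAt.eventually_mem (by rw [hF0]; exact ball_mem_nhds _ hη)
    filter_upwards [nhdsWithin_le_nhds h1, nhdsWithin_le_nhds (ball_mem_nhds (0 : ℂ) hδ),
      nhdsWithin_le_nhds (ball_mem_nhds (0 : ℂ) one_pos)] with v hv1 hv2 hv3
    rw [hypQuotient, hδe v hv2, ← hcomm v hv3, ← hcomm 0 h0, hF0, hηe _ hv1]
  obtain ⟨r, hr, hsub⟩ := Metric.isOpen_iff.1 hU _ (hπm h0)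
  obtain ⟨s, hs, hsm, hs0, hsec⟩ := hπ.exists_section h0 hr hsub
  have hr0 : (r : ℂ) ≠ 0 := by exact_mod_cast hr.ne'
  have hball : ∀ z ∈ ball (π 0) r, π (s ((z - π 0) / r)) = z := by
    intro z hz
    have hx : (z - π 0) / r ∈ ball (0 : ℂ) 1 := by
      rw [mem_ball, dist_eq_norm] at hz
      rw [mem_ball_zero_iff, norm_div, Complex.norm_real, Real.norm_of_nonneg hr.le]
      exact (div_lt_one hr).2 hz
    rw [hsec _ hx, mul_div_cancel₀ _ hr0, add_sub_cancel]
  -- The inverse branch at π(0) transfers the limit from the disk to the plane.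
  have hst : Tendsto (fun z => s ((z - π 0) / r)) (𝓝[≠] (π 0)) (𝓝[≠] 0) := by
    refine tendsto_nhdsWithin_iff.2 ⟨?_, ?_⟩
    · have hsc : ContinuousAt s ((π 0 - π 0) / r) := by
        rw [sub_self, zero_div]
        exact hs.continuousOn.continuousAt (isOpen_ball.mem_nhds h0)
      have hcomp : ContinuousAt (fun z => s ((z - π 0) / r)) (π 0) :=
        ContinuousAt.comp (f := fun z => (z - π 0) / r) hsc (by fun_prop)
      have := hcomp.tendsto
      simp only [sub_self, zero_div, hs0] at this
      exact this.mono_left nhdsWithin_le_nhds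
    · filter_upwards [nhdsWithin_le_nhds (ball_mem_nhds (π 0) hr), self_mem_nhdsWithin]
        with z hz hne h
      refine hne ?_
      rw [mem_singleton_iff] at h ⊢
      rw [← hball z hz, h]
  refine (hQ.comp hst).congr' ?_
  filter_upwards [nhdsWithin_le_nhds (ball_mem_nhds (π 0) hr)] with z hz
  rw [Function.comp_apply, hball z hz]

/-! ### Fatou components along the orbit -/

lemma IsTranscendentalEntire.isOpenMap {f : ℂ → ℂ} (hf : IsTranscendentalEntire f) :
    IsOpenMap f := by
  have hA : AnalyticOnNhd ℂ f univ := hf.1.differentiableOn.analyticOnNhd isOpen_univ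
  refine (hA.is_constant_or_isOpenMap).resolve_left ?_
  rintro ⟨c, hc⟩
  exact hf.2 ⟨Polynomial.C c, fun z => by simp [hc z]⟩

lemma isOpen_fatouSet (f : ℂ → ℂ) : IsOpen (fatouSet f) := by
  rw [isOpen_iff_mem_nhds]
  rintro z ⟨V, hV, hz, hn⟩
  exact mem_of_superset (hV.mem_nhds hz) fun y hy => ⟨V, hV, hy, hn⟩

/-- Normality on the image is normality of the iterates with exponents shifted by one. The limit at
x depends only on f(x), so it descends to f(V); openness of f carries neighbourhoods across. -/
lemma IteratesNormalOn.image {f : ℂ → ℂ} (ho : IsOpenMap f) {V : Set ℂ}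
    (hV : IsOpen V) (h : IteratesNormalOn f V) : IteratesNormalOn f (f '' V) := by
  intro n
  obtain ⟨φ, hφ, hlim⟩ := h fun k => n k + 1
  refine ⟨φ, hφ, hlim.imp ?_ ?_⟩
  · rintro ⟨g, hg⟩
    have hinv : ∀ x ∈ V, g (Function.invFunOn f V (f x)) = g x := by
      intro x hx
      have hex : ∃ y ∈ V, f y = f x := ⟨x, hx, rfl⟩
      have h1 := hg.tendsto_at (Function.invFunOn_mem hex)
      have h2 := hg.tendsto_at hx
      refine tendsto_nhds_unique h1 (h2.congr fun k => ?_)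
      simp only [Function.iterate_succ, Function.comp_apply, Function.invFunOn_eq hex]
    refine ⟨g ∘ Function.invFunOn f V, ?_⟩
    rw [Metric.tendstoLocallyUniformlyOn_iff] at hg ⊢
    rintro ε hε _ ⟨x, hx, rfl⟩
    obtain ⟨t, ht, htε⟩ := hg ε hε x hx
    rw [hV.nhdsWithin_eq hx] at ht
    refine ⟨f '' (t ∩ V), mem_nhdsWithin_of_mem_nhds
      (ho.image_mem_nhds (inter_mem ht (hV.mem_nhds hx))), htε.mono fun k hk => ?_⟩
    rintro _ ⟨y, ⟨hyt, hyV⟩, rfl⟩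
    rw [Function.comp_apply, hinv y hyV]
    exact hk y hyt
  · intro hg K hK hKc R
    have hcov : ∀ y ∈ K, ∃ C : Set ℂ, IsCompact C ∧ C ⊆ V ∧ f '' C ∈ 𝓝 y := by
      intro y hy
      obtain ⟨x, hx, rfl⟩ := hK hy
      obtain ⟨C, hC, hCV, hCc⟩ := local_compact_nhds (hV.mem_nhds hx)
      exact ⟨C, hCc, hCV, ho.image_mem_nhds hC⟩
    choose! C hCc hCV hCn using hcov
    obtain ⟨T, hTK, hT⟩ := hKc.elim_nhds_subcover (fun y => f '' C y) hCn
    have hall : ∀ᶠ k in atTop, ∀ y ∈ T, ∀ x ∈ C y, R < ‖f^[n (φ k) + 1] x‖ :=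
      (T.eventually_all).2 fun y hy => hg (C y) (hCV y (hTK y hy)) (hCc y (hTK y hy)) R
    filter_upwards [hall] with k hk z hz
    obtain ⟨y, hy, x, hx, rfl⟩ := mem_iUnion₂.1 (hT hz)
    simpa using hk y hy x hx

lemma fatouSet_mapsTo {f : ℂ → ℂ} (hf : IsTranscendentalEntire f) :
    MapsTo f (fatouSet f) (fatouSet f) := by
  rintro z ⟨V, hV, hz, hn⟩
  exact ⟨f '' V, hf.isOpenMap V hV, mem_image_of_mem f hz,
    hn.image hf.isOpenMap hV⟩

lemma iterate_mem_fatouSet {f : ℂ → ℂ} (hf : IsTranscendentalEntire f) {z : ℂ}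
    (hz : z ∈ fatouSet f) (n : ℕ) : f^[n] z ∈ fatouSet f :=
  (fatouSet_mapsTo hf).iterate n hz

lemma fatouOrbit_eq {f : ℂ → ℂ} (hf : IsTranscendentalEntire f) {U : Set ℂ}
    (hU : IsFatouComponent f U) {z : ℂ} (hz : z ∈ U) (n : ℕ) :
    fatouOrbit f U n = connectedComponentIn (fatouSet f) (f^[n] z) := by
  obtain ⟨z₁, hz₁, rfl⟩ := hU
  have hzF : z ∈ fatouSet f := connectedComponentIn_subset _ _ hz
  have hzn := iterate_mem_fatouSet hf hzF n
  refine Subset.antisymm (sUnion_subset ?_) (subset_sUnion_of_mem ⟨⟨_, hzn, rfl⟩, ?_⟩)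
  · rintro V ⟨⟨y, hy, rfl⟩, hV⟩
    rw [connectedComponentIn_eq (hV (mem_image_of_mem _ hz))]
  · refine (isPreconnected_connectedComponentIn.image _
      (hf.1.continuous.iterate n).continuousOn).subset_connectedComponentIn
      (mem_image_of_mem _ hz) ?_
    rintro _ ⟨y, hy, rfl⟩
    exact iterate_mem_fatouSet hf (connectedComponentIn_subset _ _ hy) n

section

variable {f : ℂ → ℂ} {U : Set ℂ} {z : ℂ}

lemma isOpen_fatouOrbit (hf : IsTranscendentalEntire f) (hU : IsFatouComponent f U)
    (hz : z ∈ U) (n : ℕ) : IsOpen (fatouOrbit f U n) := by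
  rw [fatouOrbit_eq hf hU hz]
  exact (isOpen_fatouSet f).connectedComponentIn

lemma isPreconnected_fatouOrbit (hf : IsTranscendentalEntire f) (hU : IsFatouComponent f U)
    (hz : z ∈ U) (n : ℕ) : IsPreconnected (fatouOrbit f U n) := by
  rw [fatouOrbit_eq hf hU hz]
  exact isPreconnected_connectedComponentIn

lemma iterate_mem_fatouOrbit (hf : IsTranscendentalEntire f) (hU : IsFatouComponent f U)
    (hz : z ∈ U) (n : ℕ) : f^[n] z ∈ fatouOrbit f U n := by
  rw [fatouOrbit_eq hf hU hz]
  obtain ⟨z₁, hz₁, rfl⟩ := hU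
  exact mem_connectedComponentIn
    (iterate_mem_fatouSet hf (connectedComponentIn_subset _ _ hz) n)

lemma fatouOrbit_mapsTo (hf : IsTranscendentalEntire f) (hU : IsFatouComponent f U)
    (hz : z ∈ U) (n : ℕ) : MapsTo f (fatouOrbit f U n) (fatouOrbit f U (n + 1)) := by
  have hmem := iterate_mem_fatouOrbit hf hU hz n
  have hsub : fatouOrbit f U n ⊆ fatouSet f := by
    rw [fatouOrbit_eq hf hU hz]; exact connectedComponentIn_subset _ _
  rw [fatouOrbit_eq hf hU hz (n + 1), Function.iterate_succ_apply', mapsTo_iff_image_subset]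
  exact ((isPreconnected_fatouOrbit hf hU hz n).image f
    hf.1.continuous.continuousOn).subset_connectedComponentIn (mem_image_of_mem f hmem)
    ((image_mono hsub).trans (fatouSet_mapsTo hf).image_subset)

lemma disjoint_fatouOrbit (hf : IsTranscendentalEntire f) (hU : IsWanderingDomain f U)
    (hz : z ∈ U) {m n : ℕ} (hmn : m ≠ n) : Disjoint (fatouOrbit f U m) (fatouOrbit f U n) := by
  refine Set.disjoint_left.2 fun x hxm hxn => hU.2 m n hmn ?_
  rw [fatouOrbit_eq hf hU.1 hz] at hxm hxn ⊢
  rw [fatouOrbit_eq hf hU.1 hz, connectedComponentIn_eq hxm, connectedComponentIn_eq hxn]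

/-- Every component `U_n` of a wandering orbit is holomorphically covered by the disk. -/
lemma exists_isDiscLifting_fatouOrbit (hf : IsTranscendentalEntire f)
    (hU : IsWanderingDomain f U) (hz : z ∈ U) (n : ℕ) :
    ∃ π : ℂ → ℂ, IsDiscLifting π (fatouOrbit f U n) ∧
      MapsTo π (ball 0 1) (fatouOrbit f U n) ∧ π 0 = f^[n] z := by
  -- Wandering enters here: a disk about f^{n+1}(z) in U_{n+1} is omitted by U_n.
  obtain ⟨ε, hε, hsub⟩ := Metric.isOpen_iff.1 (isOpen_fatouOrbit hf hU.1 hz (n + 1)) _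
    (iterate_mem_fatouOrbit hf hU.1 hz (n + 1))
  refine exists_isDiscLifting (isOpen_fatouOrbit hf hU.1 hz n) hε (a := f^[n + 1] z)
    (fun x hx => ?_) (iterate_mem_fatouOrbit hf hU.1 hz n)
  by_contra! hlt
  exact Set.disjoint_left.1 (disjoint_fatouOrbit hf hU hz (Nat.succ_ne_self n).symm) hx
    (hsub (by rwa [mem_ball, dist_eq_norm]))

end

/-! ### Cesàro means and the scalar recursion -/

/-- `(1/n) (u_1 + … + u_n)`. -/
noncomputable def cesaroMean (u : ℕ → ℝ) (n : ℕ) : ℝ :=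
  (1 / (n : ℝ)) * ∑ k ∈ Finset.Icc 1 n, u k

lemma tendsto_cesaroMean {u : ℕ → ℝ} {l : ℝ} (h : Tendsto u atTop (𝓝 l)) :
    Tendsto (cesaroMean u) atTop (𝓝 l) := by
  have h1 := (h.comp (tendsto_add_atTop_nat 1)).cesaro
  refine h1.congr fun n => ?_
  rw [cesaroMean, one_div]
  congr 1
  rw [Finset.range_eq_Ico, ← Finset.Ico_add_one_right_eq_Icc]
  exact Finset.sum_Ico_add' u 0 n 1

lemma cesaroMean_add (u v : ℕ → ℝ) (n : ℕ) :
    cesaroMean (fun k => u k + v k) n = cesaroMean u n + cesaroMean v n := by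
  simp only [cesaroMean, Finset.sum_add_distrib, mul_add]

lemma cesaroMean_sub (u v : ℕ → ℝ) (n : ℕ) :
    cesaroMean (fun k => u k - v k) n = cesaroMean u n - cesaroMean v n := by
  simp only [cesaroMean, Finset.sum_sub_distrib, mul_sub]

lemma sum_eq_mul_cesaroMean (u : ℕ → ℝ) (n : ℕ) :
    ∑ k ∈ Finset.Icc 1 n, u k = n * cesaroMean u n := by
  rcases eq_or_ne n 0 with rfl | hn
  · simp
  · have : (n : ℝ) ≠ 0 := by exact_mod_cast hn
    rw [cesaroMean]
    field_simp

lemma cesaroMean_nonneg {u : ℕ → ℝ} (h : ∀ k, 0 ≤ u k) (n : ℕ) : 0 ≤ cesaroMean u n :=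
  mul_nonneg (by positivity) (Finset.sum_nonneg fun k _ => h k)

lemma cesaroMean_le_one {u : ℕ → ℝ} (h : ∀ k, u k ≤ 1) (n : ℕ) : cesaroMean u n ≤ 1 := by
  rcases eq_or_ne n 0 with rfl | hn
  · simp [cesaroMean]
  · have hn' : (0 : ℝ) < n := by exact_mod_cast Nat.pos_of_ne_zero hn
    rw [cesaroMean, one_div, inv_mul_le_iff₀ hn', mul_one]
    exact (Finset.sum_le_sum fun k _ => h k).trans (by simp)

lemma isBoundedUnder_le_cesaroMean {u : ℕ → ℝ} (h : ∀ k, u k ≤ 1) :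
    IsBoundedUnder (· ≤ ·) atTop (cesaroMean u) :=
  isBoundedUnder_of ⟨1, cesaroMean_le_one h⟩

lemma isCoboundedUnder_le_cesaroMean {u : ℕ → ℝ} (h : ∀ k, 0 ≤ u k) :
    IsCoboundedUnder (· ≤ ·) atTop (cesaroMean u) :=
  (isBoundedUnder_of ⟨0, cesaroMean_nonneg h⟩ :
    IsBoundedUnder (· ≥ ·) atTop (cesaroMean u)).isCoboundedUnder_flip

lemma limsup_cesaroMean_le {u v : ℕ → ℝ} (hu0 : ∀ k, 0 ≤ u k) (hv1 : ∀ k, v k ≤ 1)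
    (h : Tendsto (fun k => u k - v k) atTop (𝓝 0)) :
    limsup (cesaroMean u) atTop ≤ limsup (cesaroMean v) atTop := by
  refine le_of_forall_gt_imp_ge_of_dense fun c hc => ?_
  obtain ⟨c', hc', hcc⟩ := exists_between hc
  refine limsup_le_of_le (isCoboundedUnder_le_cesaroMean hu0) ?_
  filter_upwards [eventually_lt_of_limsup_lt hc' (isBoundedUnder_le_cesaroMean hv1),
    (tendsto_cesaroMean h).eventually (gt_mem_nhds (sub_pos.2 hcc))] with n h1 h2
  rw [cesaroMean_sub] at h2
  linarith

lemma limsup_cesaroMean_eq {u v : ℕ → ℝ} (hu0 : ∀ k, 0 ≤ u k) (hu1 : ∀ k, u k ≤ 1)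
    (hv0 : ∀ k, 0 ≤ v k) (hv1 : ∀ k, v k ≤ 1)
    (h : Tendsto (fun k => u k - v k) atTop (𝓝 0)) :
    limsup (cesaroMean u) atTop = limsup (cesaroMean v) atTop :=
  le_antisymm (limsup_cesaroMean_le hu0 hv1 h)
    (limsup_cesaroMean_le hv0 hu1 (by simpa using h.neg))

/-- If `r` tends to `0` and the multipliers `l` have mean asymptotically less than `c`, then `r`
decays like `c ^ n`. -/
lemma isBigO_pow_of_limsup_lt {r l : ℕ → ℝ} (hr0 : ∀ n, 0 ≤ r n) (hl0 : ∀ n, 0 ≤ l n)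
    (hl1 : ∀ n, l n ≤ 1) (hrl : ∀ n, r (n + 1) ≤ r n * (l n + r n))
    (hr : Tendsto r atTop (𝓝 0)) {c : ℝ} (hc : 0 < c)
    (hlim : limsup (cesaroMean l) atTop < c) : r =O[atTop] fun n => c ^ n := by
  obtain ⟨c', hc', hcc⟩ := exists_between hlim
  have hprod : ∀ n, r (n + 1) ≤ r 1 * ∏ k ∈ Finset.Icc 1 n, (l k + r k) := by
    intro n
    induction n with
    | zero => simp
    | succ n ih =>
      rw [Finset.prod_Icc_succ_top (by omega), ← mul_assoc]
      exact (hrl (n + 1)).trans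
        (mul_le_mul_of_nonneg_right ih (add_nonneg (hl0 _) (hr0 _)))
  have hev : ∀ᶠ n in atTop, r (n + 1) ≤ r 1 * c ^ n := by
    filter_upwards [eventually_lt_of_limsup_lt hc' (isBoundedUnder_le_cesaroMean hl1),
      (tendsto_cesaroMean hr).eventually (gt_mem_nhds (sub_pos.2 hcc))] with n h1 h2
    refine (hprod n).trans (mul_le_mul_of_nonneg_left ?_ (hr0 1))
    have hsum : ∑ k ∈ Finset.Icc 1 n, (l k + r k) ≤ n * c := by
      rw [sum_eq_mul_cesaroMean (fun k => l k + r k), cesaroMean_add]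
      exact mul_le_mul_of_nonneg_left (by linarith) (Nat.cast_nonneg n)
    -- The inequality x ≤ c exp(x/c - 1) in each factor plays the role of the inequality of
    -- arithmetic and geometric means and tolerates zero factors.
    have hle : ∏ k ∈ Finset.Icc 1 n, (l k + r k) ≤
        ∏ k ∈ Finset.Icc 1 n, (c * Real.exp ((l k + r k) / c - 1)) := by
      refine Finset.prod_le_prod (fun k _ => add_nonneg (hl0 k) (hr0 k)) fun k _ => ?_
      have := Real.add_one_le_exp ((l k + r k) / c - 1)
      rw [sub_add_cancel, div_le_iff₀ hc] at this
      linarith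
    refine hle.trans ?_
    rw [Finset.prod_mul_distrib, Finset.prod_const, ← Real.exp_sum, Nat.card_Icc,
      Nat.add_sub_cancel]
    refine mul_le_of_le_one_right (by positivity) (Real.exp_le_one_iff.2 ?_)
    rw [Finset.sum_sub_distrib, ← Finset.sum_div]
    simp only [Finset.sum_const, Nat.card_Icc, Nat.add_sub_cancel, nsmul_eq_mul, mul_one]
    rw [sub_nonpos, div_le_iff₀ hc]
    exact hsum
  obtain ⟨N, hN⟩ := eventually_atTop.1 hev
  -- The division by c absorbs the index shift from n + 1 to n.
  refine IsBigO.of_bound (r 1 / c) (eventually_atTop.2 ⟨N + 1, fun n hn => ?_⟩)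
  obtain ⟨m, rfl⟩ := Nat.exists_eq_succ_of_ne_zero (by omega : n ≠ 0)
  have h1 := hN m (by omega)
  rw [Real.norm_of_nonneg (hr0 _), Real.norm_of_nonneg (by positivity)]
  refine h1.trans_eq ?_
  rw [Nat.succ_eq_add_one, pow_succ]
  field_simp

/-- If `r` does not tend to `0`, then the multipliers `l` have mean tending to `1`. -/
lemma tendsto_zero_or_tendsto_cesaroMean_one {r l : ℕ → ℝ} (hr0 : ∀ n, 0 ≤ r n)
    (hr1 : ∀ n, r n < 1) (hl0 : ∀ n, 0 ≤ l n) (hl1 : ∀ n, l n ≤ 1)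
    (hrl : ∀ n, r (n + 1) ≤ r n * ((r n + l n) / (1 + r n * l n))) :
    Tendsto r atTop (𝓝 0) ∨ Tendsto (cesaroMean l) atTop (𝓝 1) := by
  -- The defect from 1 is exactly (1 - r)(1 - l)/(1 + rl), with denominator at most 2.
  have hfac : ∀ n, (r n + l n) / (1 + r n * l n) ≤ 1 - (1 - r n) * (1 - l n) / 2 := by
    intro n
    have h1 : 0 < 1 + r n * l n := by have := mul_nonneg (hr0 n) (hl0 n); linarith
    have h2 : 0 ≤ (1 - r n) * (1 - l n) :=
      mul_nonneg (sub_nonneg.2 (hr1 n).le) (sub_nonneg.2 (hl1 n))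
    have h3 : r n * l n ≤ 1 := mul_le_one₀ (hr1 n).le (hl0 n) (hl1 n)
    rw [div_le_iff₀ h1]
    nlinarith [mul_nonneg h2 (sub_nonneg.2 h3)]
  have hanti : Antitone r := antitone_nat_of_succ_le fun n => by
    refine (hrl n).trans (mul_le_of_le_one_right (hr0 n) ((hfac n).trans ?_))
    have h2 : 0 ≤ (1 - r n) * (1 - l n) :=
      mul_nonneg (sub_nonneg.2 (hr1 n).le) (sub_nonneg.2 (hl1 n))
    linarith
  have hbdd : BddBelow (range r) := ⟨0, by rintro _ ⟨n, rfl⟩; exact hr0 n⟩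
  have htend := tendsto_atTop_ciInf hanti hbdd
  set L := ⨅ n, r n with hL
  rcases (le_ciInf hr0 : 0 ≤ L).eq_or_lt with h0 | hpos
  · left; rwa [h0]
  right
  have hLr : ∀ n, L ≤ r n := fun n => ciInf_le hbdd n
  set κ := (1 - r 0) / 2 with hκ
  have hκ0 : 0 < κ := by have := hr1 0; linarith
  have hstep : ∀ n, r (n + 1) ≤ r n * Real.exp (-κ * (1 - l n)) := by
    intro n
    refine (hrl n).trans (mul_le_mul_of_nonneg_left ((hfac n).trans ?_) (hr0 n))
    have h1 := Real.add_one_le_exp (-κ * (1 - l n))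
    have h2 : (1 - r 0) * (1 - l n) ≤ (1 - r n) * (1 - l n) :=
      mul_le_mul_of_nonneg_right (by linarith [hanti (Nat.zero_le n)]) (sub_nonneg.2 (hl1 n))
    rw [hκ] at h1 ⊢
    linarith
  have hprod : ∀ n, r (n + 1) ≤ r 1 * Real.exp (-κ * ∑ k ∈ Finset.Icc 1 n, (1 - l k)) := by
    intro n
    induction n with
    | zero => simp
    | succ n ih =>
      rw [Finset.sum_Icc_succ_top (by omega), mul_add, Real.exp_add, ← mul_assoc]
      exact (hstep (n + 1)).trans (mul_le_mul_of_nonneg_right ih (Real.exp_pos _).le)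
  have hr1p : 0 < r 1 := hpos.trans_le (hLr 1)
  set C := Real.log (r 1 / L) / κ with hC
  -- A positive lower bound L for r leaves only a bounded total loss log(r_1/L).
  have hsum : ∀ n, ∑ k ∈ Finset.Icc 1 n, (1 - l k) ≤ C := by
    intro n
    have h1 := (hLr (n + 1)).trans (hprod n)
    have h2 := Real.log_le_log hpos h1
    rw [Real.log_mul hr1p.ne' (Real.exp_pos _).ne', Real.log_exp] at h2
    rw [hC, le_div_iff₀ hκ0, Real.log_div hr1p.ne' hpos.ne']
    linarith
  have hlow : ∀ᶠ n : ℕ in atTop, 1 - C / n ≤ cesaroMean l n := by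
    filter_upwards [eventually_gt_atTop 0] with n hn
    have hn' : (0 : ℝ) < n := by exact_mod_cast hn
    have h1 := hsum n
    rw [Finset.sum_sub_distrib, sum_eq_mul_cesaroMean l] at h1
    simp only [Finset.sum_const, Nat.card_Icc, Nat.add_sub_cancel, nsmul_eq_mul, mul_one] at h1
    rw [sub_le_iff_le_add, ← sub_le_iff_le_add', le_div_iff₀ hn']
    linarith
  have hlim : Tendsto (fun n : ℕ => 1 - C / (n : ℝ)) atTop (𝓝 1) := by
    simpa using (tendsto_const_div_atTop_nhds_zero_nat C).const_sub 1
  exact tendsto_of_tendsto_of_tendsto_of_le_of_le' hlim tendsto_const_nhds hlow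
    (.of_forall (cesaroMean_le_one hl1))

/-! ### Derivatives of disk self-maps under recentring -/

/-- Self-maps of the disk have derivatives that are equicontinuous at the origin. -/
lemma norm_deriv_bounds {F : ℂ → ℂ} (hF : DifferentiableOn ℂ F (ball 0 1))
    (hm : MapsTo F (ball 0 1) (ball 0 1)) {w : ℂ} (hw : w ∈ ball (0 : ℂ) (1 / 2)) :
    ‖deriv F w‖ ≤ 4 ∧ |‖deriv F w‖ - ‖deriv F 0‖| ≤ 16 * ‖w‖ := by
  have hbd : ∀ x ∈ ball (0 : ℂ) (1 / 2), ‖deriv F x‖ ≤ 4 := by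
    intro x hx
    rw [mem_ball_zero_iff] at hx
    have hsub : ball x (1 / 2) ⊆ ball 0 1 := ball_subset_ball' (by
      rw [dist_zero_right]; linarith)
    have hxm : x ∈ ball x (1 / 2) := mem_ball_self (by norm_num)
    have := Complex.norm_deriv_le_div_of_mapsTo_ball (hF.mono hsub) (R₂ := 2) (fun y hy => ?_)
      (by norm_num)
    · norm_num at this; exact this
    · have h1 := mem_ball_zero_iff.1 (hm (hsub hy))
      have h2 := mem_ball_zero_iff.1 (hm (hsub hxm))
      rw [mem_closedBall, dist_eq_norm]
      linarith [norm_sub_le (F y) (F x)]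
  refine ⟨hbd w hw, (abs_norm_sub_norm_le _ _).trans ?_⟩
  have h0 : (0 : ℂ) ∈ ball (0 : ℂ) (1 / 2) := mem_ball_self (by norm_num)
  -- Derivatives bounded by 4 differ by at most 8; over radius 1/2 this gives 16.
  have := Complex.dist_le_div_mul_dist_of_mapsTo_ball (R₂ := 8)
    ((hF.deriv isOpen_ball).mono (ball_subset_ball (by norm_num : (1 / 2 : ℝ) ≤ 1)))
    (fun y hy => ?_) hw
  · rw [dist_eq_norm, dist_zero_right] at this
    norm_num at this
    exact this
  · rw [mem_closedBall, dist_eq_norm]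
    linarith [norm_sub_le (deriv F y) (deriv F 0), hbd y hy, hbd 0 h0]

/-- The conjugate of `F` by the automorphisms that move `w` and `F w` to the origin. -/
noncomputable def discRecenter (F : ℂ → ℂ) (w : ℂ) : ℂ → ℂ :=
  discSwap (F w) ∘ F ∘ discSwap w

section

variable {F : ℂ → ℂ} {w : ℂ}

lemma differentiableOn_discRecenter (hF : DifferentiableOn ℂ F (ball 0 1))
    (hm : MapsTo F (ball 0 1) (ball 0 1)) (hw : w ∈ ball (0 : ℂ) 1) :
    DifferentiableOn ℂ (discRecenter F w) (ball 0 1) :=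
  (differentiableOn_discSwap (hm hw)).comp
    (hF.comp (differentiableOn_discSwap hw) (discSwap_mapsTo hw)) (hm.comp (discSwap_mapsTo hw))

lemma discRecenter_mapsTo (hm : MapsTo F (ball 0 1) (ball 0 1)) (hw : w ∈ ball (0 : ℂ) 1) :
    MapsTo (discRecenter F w) (ball 0 1) (ball 0 1) :=
  (discSwap_mapsTo (hm hw)).comp (hm.comp (discSwap_mapsTo hw))

@[simp] lemma discRecenter_zero : discRecenter F w 0 = 0 := by simp [discRecenter]

/-- Recentring exchanges the roles of 0 and w, so the numbers |w_n| satisfy the Schwarz recursion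
for both orbits. -/
lemma discRecenter_self (hF0 : F 0 = 0) : discRecenter F w w = F w := by
  simp [discRecenter, hF0]

lemma norm_deriv_discRecenter (hF : DifferentiableOn ℂ F (ball 0 1))
    (hm : MapsTo F (ball 0 1) (ball 0 1)) (hw : w ∈ ball (0 : ℂ) 1) :
    ‖deriv (discRecenter F w) 0‖ = ‖deriv F w‖ * ((1 - ‖w‖ ^ 2) / (1 - ‖F w‖ ^ 2)) := by
  have h1 := hasDerivAt_discSwap hw (mem_ball_self one_pos)
  have h2 : HasDerivAt F (deriv F w) (discSwap w 0) := by
    rw [discSwap_zero]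
    exact (hF.differentiableAt (isOpen_ball.mem_nhds hw)).hasDerivAt
  have h3 := hasDerivAt_discSwap (hm hw) (z := (F ∘ discSwap w) 0) (by simpa using hm hw)
  have h4 : deriv (discRecenter F w) 0 = _ := (h3.comp 0 (h2.comp 0 h1)).deriv
  have hp : ∀ {x : ℂ}, x ∈ ball (0 : ℂ) 1 → 0 < 1 - ‖x‖ ^ 2 := by
    intro x hx
    rw [mem_ball_zero_iff] at hx
    nlinarith [norm_nonneg x]
  have hpw := hp hw
  have hpF := hp (hm hw)
  have e : ∀ x : ℂ, (1 : ℂ) - (‖x‖ : ℂ) ^ 2 = ((1 - ‖x‖ ^ 2 : ℝ) : ℂ) := by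
    intro x; push_cast; ring
  rw [h4, Function.comp_apply, discSwap_zero, Complex.conj_mul', e, e]
  simp only [norm_mul, norm_div, norm_neg, norm_pow, Complex.norm_real, Real.norm_eq_abs,
    abs_of_pos hpw, abs_of_pos hpF, mul_zero, sub_zero, one_pow, div_one]
  field_simp

end

/-- The ratio of hyperbolic densities tends to 1 and multiplies bounded derivatives; equicontinuity
at 0 handles the remaining difference. -/
lemma tendsto_norm_deriv_discRecenter_sub {F : ℕ → ℂ → ℂ} {w : ℕ → ℂ}
    (hF : ∀ n, DifferentiableOn ℂ (F n) (ball 0 1))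
    (hm : ∀ n, MapsTo (F n) (ball 0 1) (ball 0 1)) (hw : ∀ n, w n ∈ ball (0 : ℂ) 1)
    (hw1 : ∀ n, w (n + 1) = F n (w n)) (hw0 : Tendsto (fun n => ‖w n‖) atTop (𝓝 0)) :
    Tendsto (fun n => ‖deriv (discRecenter (F n) (w n)) 0‖ - ‖deriv (F n) 0‖) atTop (𝓝 0) := by
  have hq : Tendsto (fun n => (1 - ‖w n‖ ^ 2) / (1 - ‖F n (w n)‖ ^ 2) - 1) atTop (𝓝 0) := by
    have h1 : Tendsto (fun n => ‖F n (w n)‖) atTop (𝓝 0) :=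
      (hw0.comp (tendsto_add_atTop_nat 1)).congr fun n => by
        rw [Function.comp_apply, hw1]
    have h2 := (((hw0.pow 2).const_sub 1).div ((h1.pow 2).const_sub 1) (by norm_num)).sub_const 1
    simpa using h2
  have hsmall : ∀ᶠ n in atTop, w n ∈ ball (0 : ℂ) (1 / 2) :=
    (hw0.eventually (gt_mem_nhds (by norm_num : (0 : ℝ) < 1 / 2))).mono fun n hn => by
      rwa [mem_ball_zero_iff]
  have hbd : Tendsto (fun n => 4 * |(1 - ‖w n‖ ^ 2) / (1 - ‖F n (w n)‖ ^ 2) - 1| + 16 * ‖w n‖)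
      atTop (𝓝 0) := by
    simpa using (hq.abs.const_mul 4).add (hw0.const_mul 16)
  refine squeeze_zero_norm' (hsmall.mono fun n hn => ?_) hbd
  obtain ⟨h1, h2⟩ := norm_deriv_bounds (hF n) (hm n) hn
  rw [norm_deriv_discRecenter (hF n) (hm n) (hw n), Real.norm_eq_abs]
  set a := ‖deriv (F n) (w n)‖
  set q := (1 - ‖w n‖ ^ 2) / (1 - ‖F n (w n)‖ ^ 2)
  have h3 : a * q - ‖deriv (F n) 0‖ = a * (q - 1) + (a - ‖deriv (F n) 0‖) := by ring
  rw [h3]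
  refine (abs_add_le _ _).trans (add_le_add ?_ h2)
  rw [abs_mul, abs_of_nonneg (norm_nonneg _)]
  exact mul_le_mul_of_nonneg_right h1 (abs_nonneg _)

/-! ### The wandering orbit modelled on the disk -/

/-- A wandering orbit modelled on the disk: holomorphic coverings `π n` of the components `U_n`,
centred at the orbit of `z₀`, and the lifts `F n` of `f : U_n → U_{n+1}`. -/
structure OrbitModel (f : ℂ → ℂ) (U : Set ℂ) (z₀ : ℂ) (π F : ℕ → ℂ → ℂ) : Prop where
  isOpen : ∀ n, IsOpen (fatouOrbit f U n)
  isPreconnected : ∀ n, IsPreconnected (fatouOrbit f U n)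
  isDiscLifting : ∀ n, IsDiscLifting (π n) (fatouOrbit f U n)
  mapsTo_orbit : ∀ n, MapsTo (π n) (ball 0 1) (fatouOrbit f U n)
  map_zero : ∀ n, π n 0 = f^[n] z₀
  differentiableOn : ∀ n, DifferentiableOn ℂ (F n) (ball 0 1)
  mapsTo : ∀ n, MapsTo (F n) (ball 0 1) (ball 0 1)
  lift_zero : ∀ n, F n 0 = 0
  comm : ∀ n, ∀ w ∈ ball (0 : ℂ) 1, π (n + 1) (F n w) = f (π n w)

lemma exists_orbitModel {f : ℂ → ℂ} (hf : IsTranscendentalEntire f) {U : Set ℂ}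
    (hU : IsWanderingDomain f U) {z₀ : ℂ} (hz₀ : z₀ ∈ U) :
    ∃ π F : ℕ → ℂ → ℂ, OrbitModel f U z₀ π F := by
  choose π hπ hπm hπ0 using exists_isDiscLifting_fatouOrbit hf hU hz₀
  have hlift := fun n => (hπ (n + 1)).exists_lift (f ∘ π n)
    (hf.1.comp_differentiableOn (hπ n).differentiableOn)
    ((fatouOrbit_mapsTo hf hU.1 hz₀ n).comp (hπm n)) 0 (mem_ball_self one_pos)
    (by rw [hπ0, Function.comp_apply, hπ0, Function.iterate_succ_apply'])
  choose F hF hFm hF0 hFc using hlift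
  exact ⟨π, F, isOpen_fatouOrbit hf hU.1 hz₀, isPreconnected_fatouOrbit hf hU.1 hz₀, hπ, hπm, hπ0,
    hF, hFm, hF0, hFc⟩

/-- The orbit of `w` under the lifts `F n`. -/
def liftedOrbit (F : ℕ → ℂ → ℂ) (w : ℂ) : ℕ → ℂ
  | 0 => w
  | n + 1 => F n (liftedOrbit F w n)

lemma IsFatouComponent.fatouOrbit_zero {f : ℂ → ℂ} {U : Set ℂ} (hf : IsTranscendentalEntire f)
    (hU : IsFatouComponent f U) {z : ℂ} (hz : z ∈ U) : fatouOrbit f U 0 = U := by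
  rw [fatouOrbit_eq hf hU hz]
  obtain ⟨y, hy, rfl⟩ := hU
  exact (connectedComponentIn_eq hz).symm

namespace OrbitModel

variable {f : ℂ → ℂ} {U : Set ℂ} {z₀ : ℂ} {π F : ℕ → ℂ → ℂ}

lemma liftedOrbit_mem (h : OrbitModel f U z₀ π F) {w : ℂ} (hw : w ∈ ball (0 : ℂ) 1) (n : ℕ) :
    liftedOrbit F w n ∈ ball (0 : ℂ) 1 := by
  induction n with
  | zero => exact hw
  | succ n ih => exact h.mapsTo n ih

lemma map_liftedOrbit (h : OrbitModel f U z₀ π F) {w : ℂ} (hw : w ∈ ball (0 : ℂ) 1) (n : ℕ) :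
    π n (liftedOrbit F w n) = f^[n] (π 0 w) := by
  induction n with
  | zero => rfl
  | succ n ih =>
    rw [liftedOrbit, h.comm n _ (h.liftedOrbit_mem hw n), ih, Function.iterate_succ_apply']

lemma tendsto_hypQuotient (h : OrbitModel f U z₀ π F) {w : ℂ} (hw : w ∈ ball (0 : ℂ) 1) (n : ℕ) :
    Tendsto (hypQuotient f (fatouOrbit f U n) (fatouOrbit f U (n + 1)) (f^[n] (π 0 w)))
      (𝓝[≠] (f^[n] (π 0 w))) (𝓝 ‖deriv (discRecenter (F n) (liftedOrbit F w n)) 0‖) := by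
  have hn := h.liftedOrbit_mem hw n
  have hn1 := h.mapsTo n hn
  have := _root_.tendsto_hypQuotient (f := f) (F := discRecenter (F n) (liftedOrbit F w n))
    ((h.isDiscLifting n).comp_discSwap hn)
    ((h.mapsTo_orbit n).comp (discSwap_mapsTo hn)) (h.isOpen n) (h.isPreconnected n)
    ((h.isDiscLifting (n + 1)).comp_discSwap hn1)
    ((h.mapsTo_orbit (n + 1)).comp (discSwap_mapsTo hn1)) (h.isOpen (n + 1))
    (h.isPreconnected (n + 1)) (differentiableOn_discRecenter (h.differentiableOn n)
      (h.mapsTo n) hn) discRecenter_zero (fun x hx => by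
        have hx' := discSwap_mem hn hx
        rw [discRecenter, Function.comp_apply, Function.comp_apply, Function.comp_apply,
          discSwap_discSwap hn1 (h.mapsTo n hx'), h.comm n _ hx', Function.comp_apply])
  rwa [Function.comp_apply, discSwap_zero, h.map_liftedOrbit hw] at this

lemma orbitDistortion_eq (h : OrbitModel f U z₀ π F) {w : ℂ} (hw : w ∈ ball (0 : ℂ) 1) (n : ℕ) :
    orbitDistortion f U n (π 0 w) = ‖deriv (discRecenter (F n) (liftedOrbit F w n)) 0‖ :=
  (h.tendsto_hypQuotient hw n).limUnder_eq

lemma liftedOrbit_zero (h : OrbitModel f U z₀ π F) (n : ℕ) : liftedOrbit F 0 n = 0 := by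
  induction n with
  | zero => rfl
  | succ n ih => rw [liftedOrbit, ih, h.lift_zero]

lemma orbitDistortion_center (h : OrbitModel f U z₀ π F) (n : ℕ) :
    orbitDistortion f U n z₀ = ‖deriv (F n) 0‖ := by
  have h0 : (0 : ℂ) ∈ ball (0 : ℂ) 1 := mem_ball_self one_pos
  have := h.orbitDistortion_eq h0 n
  rw [norm_deriv_discRecenter (h.differentiableOn n) (h.mapsTo n) (h.liftedOrbit_mem h0 n),
    h.liftedOrbit_zero, h.lift_zero, h.map_zero] at this
  simpa using this

lemma norm_deriv_discRecenter_le_one (h : OrbitModel f U z₀ π F) {w : ℂ}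
    (hw : w ∈ ball (0 : ℂ) 1) (n : ℕ) :
    ‖deriv (discRecenter (F n) (liftedOrbit F w n)) 0‖ ≤ 1 := by
  have hn := h.liftedOrbit_mem hw n
  refine Complex.norm_deriv_le_one_of_mapsTo_ball
    (differentiableOn_discRecenter (h.differentiableOn n) (h.mapsTo n) hn) ?_ one_pos
  rw [discRecenter_zero]
  exact (discRecenter_mapsTo (h.mapsTo n) hn).mono_right ball_subset_closedBall

lemma orbitDistortion_center_mem (h : OrbitModel f U z₀ π F) (n : ℕ) :
    0 ≤ orbitDistortion f U n z₀ ∧ orbitDistortion f U n z₀ ≤ 1 := by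
  have h0 : (0 : ℂ) ∈ ball (0 : ℂ) 1 := mem_ball_self one_pos
  have hz : z₀ = π 0 0 := (h.map_zero 0).symm
  rw [hz, h.orbitDistortion_eq h0]
  exact ⟨norm_nonneg _, h.norm_deriv_discRecenter_le_one h0 n⟩

lemma norm_liftedOrbit_succ_le (h : OrbitModel f U z₀ π F) {w : ℂ} (hw : w ∈ ball (0 : ℂ) 1)
    (n : ℕ) : ‖liftedOrbit F w (n + 1)‖ ≤ ‖liftedOrbit F w n‖ *
      ((‖liftedOrbit F w n‖ + orbitDistortion f U n z₀) /
        (1 + ‖liftedOrbit F w n‖ * orbitDistortion f U n z₀)) := by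
  rw [h.orbitDistortion_center]
  exact norm_le_of_deriv_zero (h.differentiableOn n) (h.mapsTo n) (h.lift_zero n)
    (h.liftedOrbit_mem hw n)

/-- The scalar dichotomy is applied twice to the same |w_n|, once with the distortions at each of
the two points. -/
lemma tendsto_zero_or (h : OrbitModel f U z₀ π F) {w : ℂ} (hw : w ∈ ball (0 : ℂ) 1) :
    Tendsto (fun n => ‖liftedOrbit F w n‖) atTop (𝓝 0) ∨
      (Tendsto (averageDistortion f U z₀) atTop (𝓝 1) ∧
        Tendsto (averageDistortion f U (π 0 w)) atTop (𝓝 1)) := by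
  have hlt : ∀ n, ‖liftedOrbit F w n‖ < 1 := fun n =>
    mem_ball_zero_iff.1 (h.liftedOrbit_mem hw n)
  have h1 := tendsto_zero_or_tendsto_cesaroMean_one (fun n => norm_nonneg _) hlt
    (fun n => (h.orbitDistortion_center_mem n).1) (fun n => (h.orbitDistortion_center_mem n).2)
    (h.norm_liftedOrbit_succ_le hw)
  have h2 := tendsto_zero_or_tendsto_cesaroMean_one (r := fun n => ‖liftedOrbit F w n‖)
    (l := fun n => orbitDistortion f U n (π 0 w)) (fun n => norm_nonneg _) hlt
    (fun n => by rw [h.orbitDistortion_eq hw]; exact norm_nonneg _)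
    (fun n => by rw [h.orbitDistortion_eq hw]; exact h.norm_deriv_discRecenter_le_one hw n)
    (fun n => by
      have hn := h.liftedOrbit_mem hw n
      have := norm_le_of_deriv_zero
        (differentiableOn_discRecenter (h.differentiableOn n) (h.mapsTo n) hn)
        (discRecenter_mapsTo (h.mapsTo n) hn) discRecenter_zero hn
      rw [discRecenter_self (h.lift_zero n)] at this
      rw [h.orbitDistortion_eq hw]
      exact this)
  rcases h1 with h1 | h1
  · exact Or.inl h1
  · exact h2.imp_right fun h2 => ⟨h1, h2⟩

lemma tendsto_zero_of_limsup_lt (h : OrbitModel f U z₀ π F)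
    (hlim : limsup (averageDistortion f U z₀) atTop < 1) {w : ℂ} (hw : w ∈ ball (0 : ℂ) 1) :
    Tendsto (fun n => ‖liftedOrbit F w n‖) atTop (𝓝 0) :=
  (h.tendsto_zero_or hw).resolve_right fun h1 => by
    rw [h1.1.limsup_eq] at hlim
    exact lt_irrefl _ hlim

lemma liftedOrbit_isBigO (h : OrbitModel f U z₀ π F) {c : ℝ} (hc : 0 < c) (hc1 : c ≤ 1)
    (hlim : limsup (averageDistortion f U z₀) atTop < c) {w : ℂ} (hw : w ∈ ball (0 : ℂ) 1) :
    (fun n => ‖liftedOrbit F w n‖) =O[atTop] fun n => c ^ n := by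
  refine isBigO_pow_of_limsup_lt (fun n => norm_nonneg _)
    (fun n => (h.orbitDistortion_center_mem n).1) (fun n => (h.orbitDistortion_center_mem n).2)
    (fun n => (h.norm_liftedOrbit_succ_le hw n).trans ?_)
    (h.tendsto_zero_of_limsup_lt (hlim.trans_le hc1) hw) hc hlim
  have h1 := (h.orbitDistortion_center_mem n).1
  rw [add_comm (orbitDistortion f U n z₀)]
  refine mul_le_mul_of_nonneg_left (div_le_self (by positivity) ?_) (norm_nonneg _)
  exact le_add_of_nonneg_right (mul_nonneg (norm_nonneg _) h1)

lemma orbitDist_isBigO (h : OrbitModel f U z₀ π F) {c : ℝ} (hc : 0 < c) (hc1 : c ≤ 1)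
    (hlim : limsup (averageDistortion f U z₀) atTop < c) {w w' : ℂ} (hw : w ∈ ball (0 : ℂ) 1)
    (hw' : w' ∈ ball (0 : ℂ) 1) :
    orbitDist f U (π 0 w) (π 0 w') =O[atTop] fun n => c ^ n := by
  refine IsBigO.trans ?_
    ((h.liftedOrbit_isBigO hc hc1 hlim hw).add (h.liftedOrbit_isBigO hc hc1 hlim hw'))
  have ht := (h.tendsto_zero_of_limsup_lt (hlim.trans_le hc1) hw).add
    (h.tendsto_zero_of_limsup_lt (hlim.trans_le hc1) hw')
  rw [add_zero] at ht
  refine IsBigO.of_bound 4 ?_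
  filter_upwards [ht.eventually (gt_mem_nhds (by norm_num : (0 : ℝ) < 1 / 2))] with n hn
  -- The lifted points bound the hyperbolic distance from above, and for t < 1/2 it is at most 2t/(1
  -- - t) ≤ 4t.
  have hwn := h.liftedOrbit_mem hw n
  have hwn' := h.liftedOrbit_mem hw' n
  have hcov := (h.isDiscLifting n).isDiskCovering (h.mapsTo_orbit n) (h.isOpen n)
    (h.isPreconnected n)
  have hle := hcov.hypDist_le hwn hwn'
  rw [h.map_liftedOrbit hw, h.map_liftedOrbit hw', diskDist_eq_hypLog] at hle
  have h1 : ‖discSwap (liftedOrbit F w n) (liftedOrbit F w' n)‖ ≤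
      ‖liftedOrbit F w n‖ + ‖liftedOrbit F w' n‖ :=
    (norm_discSwap_le_div hwn hwn').trans
      (div_le_self (by positivity) (le_add_of_nonneg_right (by positivity)))
  set t := ‖liftedOrbit F w n‖ + ‖liftedOrbit F w' n‖ with ht
  have ht0 : 0 ≤ t := by positivity
  have h2 := (hypLog_mono (norm_nonneg _) h1 (by linarith)).trans (hypLog_le ht0 (by linarith))
  have h3 : 2 * t / (1 - t) ≤ 4 * t := by
    rw [div_le_iff₀ (by linarith)]
    nlinarith
  rw [orbitDist, Real.norm_of_nonneg (hypDist_nonneg _ _ _), Real.norm_of_nonneg ht0]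
  exact (hle.trans h2).trans h3

lemma exists_eq (h : OrbitModel f U z₀ π F) (hf : IsTranscendentalEntire f)
    (hU : IsFatouComponent f U) {z : ℂ} (hz : z ∈ U) : ∃ w ∈ ball (0 : ℂ) 1, π 0 w = z := by
  have := (h.isDiscLifting 0).image_eq (h.mapsTo_orbit 0) (h.isOpen 0) (h.isPreconnected 0)
  rw [hU.fatouOrbit_zero hf hz] at this
  rwa [← this] at hz

lemma limsup_averageDistortion_eq (h : OrbitModel f U z₀ π F) {w : ℂ}
    (hw : w ∈ ball (0 : ℂ) 1) :
    limsup (averageDistortion f U (π 0 w)) atTop = limsup (averageDistortion f U z₀) atTop := by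
  rcases h.tendsto_zero_or hw with h0 | ⟨h1, h2⟩
  · refine limsup_cesaroMean_eq (u := fun n => orbitDistortion f U n (π 0 w))
      (v := fun n => orbitDistortion f U n z₀)
      (fun n => by rw [h.orbitDistortion_eq hw]; exact norm_nonneg _)
      (fun n => by rw [h.orbitDistortion_eq hw]; exact h.norm_deriv_discRecenter_le_one hw n)
      (fun n => (h.orbitDistortion_center_mem n).1) (fun n => (h.orbitDistortion_center_mem n).2)
      ?_
    refine (tendsto_norm_deriv_discRecenter_sub h.differentiableOn h.mapsTo
      (h.liftedOrbit_mem hw) (fun n => rfl) h0).congr fun n => ?_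
    rw [h.orbitDistortion_eq hw, h.orbitDistortion_center]
  · rw [h1.limsup_eq, h2.limsup_eq]

end OrbitModel

/-! ### Root asymptotics and the theorem -/

/-- A nonnegative sequence that is `O(c ^ n)` for every `c > 0` has `n`-th roots tending to `0`. -/
lemma tendsto_rpow_one_div_of_isBigO_pow {d : ℕ → ℝ} (hd : ∀ n, 0 ≤ d n)
    (h : ∀ c : ℝ, 0 < c → c ≤ 1 → d =O[atTop] fun n => c ^ n) :
    Tendsto (fun n : ℕ => d n ^ (1 / (n : ℝ))) atTop (𝓝 0) := by
  rw [Metric.tendsto_nhds]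
  intro ε hε
  -- Since C^(1/n) is eventually below 2, the n-th root is then at most ε/2.
  set c := min (ε / 4) 1 with hc
  have hc0 : 0 < c := by positivity
  obtain ⟨C, hC, hb⟩ := (h c hc0 (min_le_right _ _)).exists_pos
  have hroot : Tendsto (fun n : ℕ => C ^ (1 / (n : ℝ))) atTop (𝓝 1) := by
    have := (tendsto_const_nhds (x := C)).rpow (tendsto_const_div_atTop_nhds_zero_nat (1 : ℝ))
      (Or.inl hC.ne')
    simpa using this
  filter_upwards [hb.bound, hroot.eventually (gt_mem_nhds (by norm_num : (1 : ℝ) < 2)),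
    eventually_gt_atTop 0] with n h1 h2 hn
  have hn' : (n : ℝ) ≠ 0 := by exact_mod_cast hn.ne'
  rw [Real.norm_of_nonneg (hd n), Real.norm_of_nonneg (by positivity)] at h1
  have h3 := Real.rpow_le_rpow (hd n) h1 (by positivity : 0 ≤ 1 / (n : ℝ))
  rw [Real.mul_rpow hC.le (by positivity), one_div, Real.pow_rpow_inv_natCast hc0.le hn.ne',
    ← one_div] at h3
  rw [Real.dist_eq, sub_zero, abs_of_nonneg (Real.rpow_nonneg (hd n) _)]
  have h4 : c ≤ ε / 4 := min_le_left _ _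
  have h5 := Real.rpow_nonneg hC.le (1 / (n : ℝ))
  nlinarith

theorem theoremB (f : ℂ → ℂ) (hf : IsTranscendentalEntire f)
    (U : Set ℂ) (hU : IsWanderingDomain f U) (hsc : IsSimplyConnected U)
    (z₀ : ℂ) (hz₀ : z₀ ∈ U) :
    -- the distortions are well defined, with values in `[0, 1]`
    (∀ z ∈ U, ∀ n : ℕ,
      Tendsto (hypQuotient f (fatouOrbit f U n) (fatouOrbit f U (n + 1)) (f^[n] z))
        (𝓝[≠] (f^[n] z)) (𝓝 (orbitDistortion f U n z)) ∧
      0 ≤ orbitDistortion f U n z ∧ orbitDistortion f U n z ≤ 1) ∧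
    (limsup (averageDistortion f U z₀) atTop < 1 → IsStronglyContracting f U) ∧
    (Tendsto (averageDistortion f U z₀) atTop (𝓝 0) → IsSuperContracting f U) ∧
    (∀ z ∈ U, limsup (averageDistortion f U z) atTop =
      limsup (averageDistortion f U z₀) atTop) := by
  obtain ⟨π, F, h⟩ := exists_orbitModel hf hU hz₀
  refine ⟨fun z hz n => ?_, fun hlim => ?_, fun hlim z hz z' hz' => ?_, fun z hz => ?_⟩
  · obtain ⟨w, hw, rfl⟩ := h.exists_eq hf hU.1 hz
    rw [h.orbitDistortion_eq hw]
    exact ⟨h.tendsto_hypQuotient hw n, norm_nonneg _, h.norm_deriv_discRecenter_le_one hw n⟩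
  -- The maximum with 0 makes c positive as well as larger than the limsup.
  · obtain ⟨c, hc, hc1⟩ := exists_between (max_lt hlim one_pos)
    have hc0 : 0 < c := (le_max_right _ _).trans_lt hc
    refine ⟨c, hc0, hc1, fun z hz z' hz' => ?_⟩
    obtain ⟨w, hw, rfl⟩ := h.exists_eq hf hU.1 hz
    obtain ⟨w', hw', rfl⟩ := h.exists_eq hf hU.1 hz'
    exact h.orbitDist_isBigO hc0 hc1.le ((le_max_left _ _).trans_lt hc) hw hw'
  · obtain ⟨w, hw, rfl⟩ := h.exists_eq hf hU.1 hz
    obtain ⟨w', hw', rfl⟩ := h.exists_eq hf hU.1 hz'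
    exact tendsto_rpow_one_div_of_isBigO_pow (fun n => hypDist_nonneg _ _ _)
      fun c hc hc1 => h.orbitDist_isBigO hc hc1 (by rwa [hlim.limsup_eq]) hw hw'
  · obtain ⟨w, hw, rfl⟩ := h.exists_eq hf hU.1 hz
    exact h.limsup_averageDistortion_eq hw
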